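/- Binary strings, natural numbers and tuples of them are identified with natural numbers by a fixed standard computable coding; $\epsilon$ is the empty string and $l(p)$ the length of $p$. A \emph{prefix machine} is a partial recursive function $T(p,c)$ of a program $p\in\{0,1\}^*$ and a condition $c$ such that for each $c$ no halting program is a proper prefix of another. A prefix machine $U$ is \emph{universal} if for every prefix machine $T$ there is a constant $k_T$ such that whenever $T(p,c)=n$ there is $q$ with $U(q,c)=n$ and $l(q)\le l(p)+k_T$. Fix any universal prefix machine $U$, and let $K(x\mid y)=\min\{l(p):U(p,y)=x\}$, $K(x)=K(x\mid\epsilon)$, let $x^*$ be the lexicographically first shortest program $p$ with $U(p,\epsilon)=x$, and put $\mathbf m(x\mid y)=2^{-K(x\mid y)}$ and $I(x:y)=K(y)-K(y\mid x^*)$ (the information in $x$ about $y$). \textbf{Theorem (randomized non-increase).} (1) There is a constant $c_3$ such that for all $x,y,z\in\{0,1\}^*$ \[ \mathbf m(z\mid x^*)\,2^{I(z:y)-I(x:y)}\le c_3\,\mathbf m\bigl(z\mid x^*,y,K(y\mid x^*)\bigr). \] (2) Consequently there is a constant $c$ such that for all $x,y\in\{0,1\}^*$ \[ \sum_{z}\mathbf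 m(z\mid x^*)\,2^{I(z:y)-I(x:y)}\le c . \] (3) Consequently, under randomized processing, mutual information increases by $d$ only with probability $O(2^{-d})$: there is a constant $c$ such that for all $x,y\in\{0,1\}^*$ and all integers $d$ \[ \sum_{z:\,I(z:y)-I(x:y)\ge d}\mathbf m(z\mid x^*)\le c\,2^{-d}, \] and for every lower semicomputable $f(z\mid x)\ge 0$ with $\sum_z f(z\mid x)\le 1$ for all $x$ (the probability that a randomized computation produces $z$ from $x$) there is a constant $c_f$ such that for all $x,y\in\{0,1\}^*$ and all integers $d$ \[ \sum_{z:\,I(z:y)-I(x:y)\ge d} f(z\mid x)\le c_f\,2^{-d}. \] -/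

import Mathlib

/-! Finite objects (binary strings `List Bool`, natural numbers, tuples of these) are identified with
natural numbers through Mathlib's effective coding `Encodable.encode`; the empty string has
code `0`. Tuples are coded by means of the pairing function `Nat.pair`. -/

open Encodable

/-- A (conditional) prefix machine: `U p c` is the output, if any, of the program `p` with the
condition `c` as auxiliary input. It is partial recursive, and for each condition the set of
halting programs is prefix-free. -/
structure IsPrefixMachine (U : List Bool → ℕ →. ℕ) : Prop where
  partrec : Partrec₂ U
  prefix_free : ∀ (c : ℕ) (p q : List Bool), (U p c).Dom → (U q c).Dom → p <+: q → p = q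

/-- A universal prefix machine: a prefix machine that simulates each prefix machine `T` at the cost
of lengthening the programs by at most a constant `k` (which depends on `T` only). -/
structure IsUniversalPrefixMachine (U : List Bool → ℕ →. ℕ) : Prop extends IsPrefixMachine U where
  simulates : ∀ T : List Bool → ℕ →. ℕ, IsPrefixMachine T →
    ∃ k : ℕ, ∀ (p : List Bool) (c n : ℕ), n ∈ T p c →
      ∃ q : List Bool, n ∈ U q c ∧ q.length ≤ p.length + k

namespace Kolmogorov

/-- The programs from which `U` computes `x` given `y`. -/
def programs {α β : Type} [Primcodable α] [Primcodable β] (U : List Bool → ℕ →. ℕ)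
    (x : α) (y : β) : Set (List Bool) :=
  {p | encode x ∈ U p (encode y)}

/-- Conditional prefix complexity `K(x | y)`: the length of a shortest program for `x` given `y`.
For a universal machine the set of programs is never empty (`Kolmogorov.programs_nonempty`). -/
noncomputable def condK {α β : Type} [Primcodable α] [Primcodable β] (U : List Bool → ℕ →. ℕ)
    (x : α) (y : β) : ℕ :=
  sInf (List.length '' programs U x y)

/-- Prefix complexity `K(x) = K(x | ε)`. -/
noncomputable def K {α : Type} [Primcodable α] (U : List Bool → ℕ →. ℕ) (x : α) : ℕ :=
  condK U x ([] : List Bool)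

open Classical in
/-- `x^*`: the first program for `x` (with empty condition) in the order of increasing length and,
among strings of equal length, lexicographically with `0 < 1`. So it is the lexicographically first
shortest program for `x`. -/
noncomputable def star {α : Type} [Primcodable α] (U : List Bool → ℕ →. ℕ) (x : α) : List Bool :=
  if h : (programs U x ([] : List Bool)).Nonempty then
    (List.Shortlex.wf (wellFounded_lt : WellFounded ((· < ·) : Bool → Bool → Prop))).min _ h
  else []

/-- `I(x : y) = K(y) - K(y | x^*)`, the information in `x` about `y`. -/
noncomputable def I {α β : Type} [Primcodable α] [Primcodable β] (U : List Bool → ℕ →. ℕ)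
    (x : α) (y : β) : ℤ :=
  (K U y : ℤ) - (condK U y (star U x) : ℤ)

/-- The conditional universal probability `m(x | y) = 2^{-K(x | y)}`. -/
noncomputable def m {α β : Type} [Primcodable α] [Primcodable β] (U : List Bool → ℕ →. ℕ)
    (x : α) (y : β) : ℝ :=
  (2 : ℝ) ^ (-(condK U x y : ℤ))

/-- Lower semicomputability of a nonnegative real-valued function: `f a` is the limit of a
nondecreasing sequence of rationals `p / q`, computable uniformly in `a`. -/
def LowerSemicomputable {α : Type} [Primcodable α] (f : α → ℝ) : Prop :=
  ∃ φ : α → ℕ → ℕ × ℕ, Computable₂ φ ∧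
    (∀ a, Monotone fun t => ((φ a t).1 : ℝ) / ((φ a t).2 : ℝ)) ∧
    ∀ a, Filter.Tendsto (fun t => ((φ a t).1 : ℝ) / ((φ a t).2 : ℝ)) Filter.atTop (nhds (f a))

/-- A randomized computation: `f x z` is the probability `f(z | x)` that it produces `z` from the
input `x`. It is lower semicomputable, and `f(· | x)` is a (sub-)probability mass function
for each `x` (with the missing mass being that of divergence). -/
structure IsRandomizedProcessing (f : List Bool → List Bool → ℝ) : Prop where
  nonneg : ∀ x z, 0 ≤ f x z
  summable : ∀ x, Summable (f x)
  tsum_le_one : ∀ x, ∑' z, f x z ≤ 1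
  lowerSemicomputable : LowerSemicomputable fun a : List Bool × List Bool => f a.1 a.2

/-- Every object has a program on a universal prefix machine, whatever the condition. -/
theorem programs_nonempty {U : List Bool → ℕ →. ℕ} (hU : IsUniversalPrefixMachine U)
    {α β : Type} [Primcodable α] [Primcodable β] (x : α) (y : β) : (programs U x y).Nonempty := by
  have hT : IsPrefixMachine fun p _ => if p = [] then Part.some (encode x) else Part.none := by
    refine ⟨?_, ?_⟩
    · have h : Computable fun a : List Bool × ℕ => (if a.1 = [] then some (encode x) else none) :=
        (Primrec.ite (Primrec.eq.comp Primrec.fst (Primrec.const [])) (Primrec.const _)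
          (Primrec.const _)).to_comp
      refine h.ofOption.of_eq fun a => ?_
      by_cases h : a.1 = [] <;> simp [h]
    · intro c p q hp hq _
      by_cases h1 : p = [] <;> by_cases h2 : q = [] <;> simp_all
  obtain ⟨k, hk⟩ := hU.simulates _ hT
  obtain ⟨q, hq, -⟩ := hk [] (encode y) (encode x) (by simp)
  exact ⟨q, hq⟩

end Kolmogorov

/-! Universal prefix machines exist: restrict the `i`-th partial recursive function to a prefix-free
set of programs, and run it on `p` when the program is `1^i 0 p`. -/

namespace Kolmogorov.Existence

open Nat.Partrec (Code)

/-- The pair of a program and a condition coded by `n`. -/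
def cand (n : ℕ) : List Bool × ℕ := ((decode n : Option (List Bool × ℕ))).getD ([], 0)

/-- For `a = ((i, p, c), s)`: `n` codes `(q, c)` where `q ≠ p` is comparable with `p` and the `i`-th
function halts on `(q, c)` within `s` steps. -/
def Bad (a : (ℕ × List Bool × ℕ) × ℕ) (n : ℕ) : Prop :=
  (Code.evaln a.2 (Denumerable.ofNat Code a.1.1) n).isSome = true ∧ encode (cand n) = n ∧
    (cand n).2 = a.1.2.2 ∧ (cand n).1 ≠ a.1.2.1 ∧
    ((cand n).1.take a.1.2.1.length = a.1.2.1 ∨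
      a.1.2.1.take (cand n).1.length = (cand n).1)

theorem primrec_cand : Primrec cand := Primrec.option_getD.comp Primrec.decode (Primrec.const _)

theorem primrec_stage : Primrec fun b : (ℕ × List Bool × ℕ) × ℕ =>
    Code.evaln b.2 (Denumerable.ofNat Code b.1.1) (encode b.1.2) :=
  Code.primrec_evaln.comp (((Primrec.snd).pair
    ((Primrec.ofNat Code).comp (Primrec.fst.comp Primrec.fst))).pair
    (Primrec.encode.comp (Primrec.snd.comp Primrec.fst)))

theorem primrec_bad : PrimrecRel fun n a => Bad a n := by
  have hn : Primrec fun b : ℕ × ((ℕ × List Bool × ℕ) × ℕ) => b.1 := Primrec.fst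
  have hc := primrec_cand.comp hn
  have hs : Primrec fun b : ℕ × ((ℕ × List Bool × ℕ) × ℕ) => b.2.2 := Primrec.snd.comp Primrec.snd
  have hi : Primrec fun b : ℕ × ((ℕ × List Bool × ℕ) × ℕ) => b.2.1.1 :=
    Primrec.fst.comp (Primrec.fst.comp Primrec.snd)
  have hp : Primrec fun b : ℕ × ((ℕ × List Bool × ℕ) × ℕ) => b.2.1.2.1 :=
    Primrec.fst.comp (Primrec.snd.comp (Primrec.fst.comp Primrec.snd))
  have hy : Primrec fun b : ℕ × ((ℕ × List Bool × ℕ) × ℕ) => b.2.1.2.2 :=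
    Primrec.snd.comp (Primrec.snd.comp (Primrec.fst.comp Primrec.snd))
  have hq := Primrec.fst.comp hc
  refine PrimrecPred.and ?_ (PrimrecPred.and ?_ (PrimrecPred.and ?_ (PrimrecPred.and ?_
    (PrimrecPred.or ?_ ?_))))
  · exact Primrec.eq.comp (Primrec.option_isSome.comp (Code.primrec_evaln.comp
      ((hs.pair ((Primrec.ofNat Code).comp hi)).pair hn))) (Primrec.const true)
  · exact Primrec.eq.comp (Primrec.encode.comp hc) hn
  · exact Primrec.eq.comp (Primrec.snd.comp hc) hy
  · exact (Primrec.eq.comp hq hp).not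
  · exact Primrec.eq.comp (Primrec.list_take.comp (Primrec.list_length.comp hp) hq) hp
  · exact Primrec.eq.comp (Primrec.list_take.comp (Primrec.list_length.comp hq) hp) hq

theorem primrec_clash : PrimrecPred fun a : (ℕ × List Bool × ℕ) × ℕ => ∃ n < a.2, Bad a n :=
  have h := PrimrecRel.exists_mem_list primrec_bad
  (PrimrecRel.comp h (Primrec.list_range.comp Primrec.snd) Primrec.id).of_eq fun a => by simp

open Classical in
/-- The `i`-th partial recursive function, restricted to a prefix-free set of programs. -/
noncomputable def prune (a : ℕ × List Bool × ℕ) : Part ℕ :=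
  (Nat.rfind fun s => Part.some
    (Code.evaln s (Denumerable.ofNat Code a.1) (encode a.2)).isSome).bind fun s =>
      ((if ∃ n < s, Bad (a, s) n then none
        else Code.evaln s (Denumerable.ofNat Code a.1) (encode a.2) : Option ℕ) : Part ℕ)

theorem partrec_prune : Partrec prune := by
  classical
  refine Partrec.bind (Partrec.rfind ?_) ?_
  · exact ((Primrec.option_isSome.comp primrec_stage).to_comp : Computable _).partrec
  · exact (Primrec.ite primrec_clash (Primrec.const none) primrec_stage).to_comp.ofOption

theorem prune_spec {i : ℕ} {p : List Bool} {c v : ℕ} (h : v ∈ prune (i, p, c)) :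
    ∃ s, v ∈ Code.evaln s (Denumerable.ofNat Code i) (encode (p, c)) ∧
      ¬ ∃ n < s, Bad ((i, p, c), s) n := by
  simp only [prune, Part.mem_bind_iff, Part.mem_coe] at h
  obtain ⟨s, -, h⟩ := h
  split_ifs at h with hb
  · simp at h
  · exact ⟨s, h, hb⟩

theorem cand_encode (q : List Bool) (c : ℕ) : cand (encode (q, c)) = (q, c) := by
  simp only [cand, encodek, Option.getD_some]

theorem bad_of {i s : ℕ} {p q : List Bool} {c v : ℕ}
    (hq : v ∈ Code.evaln s (Denumerable.ofNat Code i) (encode (q, c))) (hne : q ≠ p)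
    (hpq : p <+: q ∨ q <+: p) : ∃ n < s, Bad ((i, p, c), s) n := by
  refine ⟨encode (q, c), Code.evaln_bound hq, ?_⟩
  rw [Option.mem_def] at hq
  refine ⟨by simp only [hq, Option.isSome_some], by rw [cand_encode], ?_⟩
  rw [cand_encode]
  exact ⟨rfl, hne, hpq.imp (fun h => (List.prefix_iff_eq_take.1 h).symm)
    fun h => (List.prefix_iff_eq_take.1 h).symm⟩

theorem prune_prefix_free (i c : ℕ) (p q : List Bool) (hp : (prune (i, p, c)).Dom)
    (hq : (prune (i, q, c)).Dom) (hpq : p <+: q) : p = q := by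
  obtain ⟨v, hv⟩ := Part.dom_iff_mem.1 hp
  obtain ⟨w, hw⟩ := Part.dom_iff_mem.1 hq
  obtain ⟨s, hs, hs'⟩ := prune_spec hv
  obtain ⟨t, ht, ht'⟩ := prune_spec hw
  by_contra hne
  rcases le_total s t with h | h
  · exact ht' (bad_of (Code.evaln_mono h hs) hne (Or.inr hpq))
  · exact hs' (bad_of (Code.evaln_mono h ht) (Ne.symm hne) (Or.inl hpq))

theorem prune_complete {T : List Bool → ℕ →. ℕ} (hT : IsPrefixMachine T) :
    ∃ i, ∀ p c n, n ∈ T p c → n ∈ prune (i, p, c) := by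
  classical
  obtain ⟨code, hcode⟩ := Code.exists_code.1 hT.partrec
  have key : ∀ (q : List Bool) (c v : ℕ), v ∈ Code.eval code (encode (q, c)) ↔ v ∈ T q c := by
    intro q c v
    rw [hcode]
    change v ∈ Part.bind (Part.ofOption (decode (encode (q, c)) : Option (List Bool × ℕ)))
      (fun a : List Bool × ℕ => Part.map encode (T a.1 a.2)) ↔ _
    rw [encodek]
    simp
  refine ⟨encode code, fun p c n hn => ?_⟩
  have hn' := (key p c n).2 hn
  obtain ⟨k, hk⟩ := Code.evaln_complete.1 hn'
  simp only [prune, Part.mem_bind_iff, Part.mem_coe, Denumerable.ofNat_encode]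
  have hdom : (Nat.rfind fun s => Part.some (Code.evaln s code (encode (p, c))).isSome).Dom := by
    refine Nat.rfind_dom.2 ⟨k, ?_, fun _ => trivial⟩
    rw [Option.mem_def] at hk
    rw [hk]
    simp
  obtain ⟨s, hs⟩ := Part.dom_iff_mem.1 hdom
  refine ⟨s, hs, ?_⟩
  have h1 := Nat.rfind_spec hs
  rw [Part.mem_some_iff] at h1
  obtain ⟨v, hv⟩ := Option.isSome_iff_exists.1 h1.symm
  have hvn : v = n := Part.mem_unique (Code.evaln_sound hv) hn'
  rw [if_neg, ← hvn]
  · exact hv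
  · rintro ⟨j, -, h2, h3, h4, h5, h6⟩
    obtain ⟨w, hw⟩ := Option.isSome_iff_exists.1 h2
    simp only [Denumerable.ofNat_encode] at hw
    have hw' := Code.evaln_sound hw
    simp only at h4 h5 h6
    have e : cand j = ((cand j).1, c) := by rw [← h4]
    rw [← h3, e] at hw'
    have hwT := (key _ _ _).1 hw'
    have d1 := Part.dom_iff_mem.2 ⟨_, hwT⟩
    have d2 := Part.dom_iff_mem.2 ⟨_, hn⟩
    rcases h6 with h6 | h6
    · exact h5 (hT.prefix_free c _ _ d2 d1 (List.prefix_iff_eq_take.2 h6.symm)).symm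
    · exact h5 (hT.prefix_free c _ _ d1 d2 (List.prefix_iff_eq_take.2 h6.symm))

theorem exists_isUniversalPrefixMachine : ∃ U, IsUniversalPrefixMachine U := by
  classical
  let pre : List Bool → ℕ := fun p => p.findIdx (fun b => !b)
  have hpre : Primrec pre := Primrec.list_findIdx Primrec.id (Primrec.not.comp Primrec.snd)
  let U : List Bool → ℕ →. ℕ := fun p c =>
    ((if pre p < p.length then some (pre p, p.drop (pre p + 1), c) else none :
      Option (ℕ × List Bool × ℕ)) : Part _).bind prune
  refine ⟨U, ⟨?_, ?_⟩, ?_⟩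
  · have h : Primrec fun a : List Bool × ℕ => (if pre a.1 < a.1.length then
        some (pre a.1, a.1.drop (pre a.1 + 1), a.2) else none : Option (ℕ × List Bool × ℕ)) := by
      have hp := hpre.comp (Primrec.fst (α := List Bool) (β := ℕ))
      exact Primrec.ite (Primrec.nat_lt.comp hp (Primrec.list_length.comp Primrec.fst))
        (Primrec.option_some.comp (hp.pair ((Primrec.list_drop.comp (Primrec.succ.comp hp)
          Primrec.fst).pair Primrec.snd))) (Primrec.const none)
    exact Partrec.bind h.to_comp.ofOption (partrec_prune.comp Computable.snd)
  · rintro c p q hp hq ⟨t, rfl⟩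
    have aux : ∀ r, (U r c).Dom → pre r < r.length ∧
        (prune (pre r, r.drop (pre r + 1), c)).Dom := by
      intro r hr
      simp only [U] at hr
      by_cases h : pre r < r.length
      · rw [if_pos h] at hr
        obtain ⟨_, h'⟩ := hr
        exact ⟨h, h'⟩
      · rw [if_neg h] at hr
        obtain ⟨h', _⟩ := hr
        exact absurd h' id
    obtain ⟨h1, h2⟩ := aux _ hp
    obtain ⟨h3, h4⟩ := aux _ hq
    have e : pre (p ++ t) = pre p := by
      simp only [pre] at h1 ⊢
      rw [List.findIdx_append, if_pos]
      simpa using h1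
    rw [e, List.drop_append_of_le_length h1] at h4
    have := prune_prefix_free _ _ _ _ h2 h4 ⟨t, rfl⟩
    simpa using this
  · intro T hT
    obtain ⟨i, hi⟩ := prune_complete hT
    refine ⟨i + 1, fun p c n hn => ⟨List.replicate i true ++ false :: p, ?_, ?_⟩⟩
    · have e : pre (List.replicate i true ++ false :: p) = i := by
        simp only [pre]
        have e0 : (List.replicate i true).findIdx (fun b => !b) = i := by
          have := List.findIdx_eq_length (xs := List.replicate i true) (p := fun b => !b)
          simpa using this
        rw [List.findIdx_append, if_neg]
        · simp [List.findIdx_cons]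
        · simp [e0]
      have e2 : (List.replicate i true ++ false :: p).drop (i + 1) = p := by
        rw [List.drop_append]; simp
      simp only [U, e, e2]
      rw [if_pos (by simp)]
      simpa using hi p c n hn
    · simp; omega

end Kolmogorov.Existence

/-!
Up to an additive constant, the logarithm of the first inequality reads
`K(y | x*) + K(z | x*, y, K(y | x*)) ≤ K(z | x*) + K(y | z*)`, and this is submodularity of prefix
complexity. It follows from the chain rule
`K(⟨a, b⟩ | w) = K(a | w) + K(b | w, a, K(a | w)) + O(1)`, which for `w = ε` takes the form
`K(⟨a, b⟩) = K(a) + K(b | a*) + O(1)`. Indeed the left-hand side is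
`K(⟨y, z⟩ | x*) = K(⟨x, y, z⟩) - K(x)`; as `y` and `x` can be computed separately from `z*`, this is
at most `K(z) + K(y | z*) + K(x | z*) - K(x)`; and `K(z) + K(x | z*) = K(⟨x, z⟩) = K(x) + K(z | x*)`
(`exists_condK_add_le`). The sum over `z` is then bounded by the Kraft inequality
(`sum_m_le_one`), and the probability of an increase by `d` by Markov's inequality
(`exists_sum_m_le`).

The chain rule rests on the coding theorem (`exists_fracVal_le_m`): the universal probability
dominates all semimeasures that are enumerable from below, uniformly in the condition. It also
dominates every randomized computation, whence the last claim. In one direction of the chain rule,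
concatenate programs (`exists_condK_pair_le`). In the other direction
(`exists_condK_add_le_condK_pair`), the total measure of the programs for pairs `⟨a, b⟩` with `a`
fixed is at most about `2 ^ (-K(a | w))`, so that this measure, multiplied by `2 ^ K(a | w)`, is an
enumerable semimeasure in `b`.

The coding theorem is proved by serving requests for code words of given lengths
(`exists_condK_le_of_requests`). No search for free code words is needed: the requests receive
consecutive intervals on the real line in the order of their arrival, and any interval of length
`2 ^ (-l)` inside `[0, 1]` contains the dyadic interval of a string of length `l + 1`.

Conditions and outputs of machines are natural numbers throughout. For objects `x` and `y`,
`condK U x y` and `condK U (encode x) (encode y)` are the same by definition.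
-/

open Encodable

namespace Kolmogorov

open Nat.Partrec (Code)

variable {U : List Bool → ℕ →. ℕ}

/-! ### The Kraft inequality -/

theorem uniquelyDecodable_of_prefixFree {α : Type*} {S : Set (List α)} (hnil : [] ∉ S)
    (hS : ∀ p ∈ S, ∀ q ∈ S, p <+: q → p = q) : InformationTheory.UniquelyDecodable S := by
  intro L₁
  induction L₁ with
  | nil =>
    intro L₂ _ h₂ h
    cases L₂ with
    | nil => rfl
    | cons w L =>
      have hw : w = [] := by
        simp only [List.flatten_nil, List.flatten_cons] at h
        exact (List.append_eq_nil_iff.1 h.symm).1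
      exact absurd (hw ▸ h₂ w (by simp)) hnil
  | cons v L ih =>
    intro L₂ h₁ h₂ h
    cases L₂ with
    | nil =>
      have hv : v = [] := by
        simp only [List.flatten_nil, List.flatten_cons] at h
        exact (List.append_eq_nil_iff.1 h).1
      exact absurd (hv ▸ h₁ v (by simp)) hnil
    | cons w L' =>
      simp only [List.flatten_cons] at h
      have hvw : v = w := by
        have hv := h₁ v (by simp)
        have hw := h₂ w (by simp)
        rcases List.prefix_or_prefix_of_prefix (List.prefix_append v L.flatten)
          (h ▸ List.prefix_append w L'.flatten) with hp | hp
        · exact hS v hv w hw hp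
        · exact (hS w hw v hv hp).symm
      subst hvw
      rw [ih L' (fun u hu => h₁ u (by simp [hu])) (fun u hu => h₂ u (by simp [hu]))
        (List.append_cancel_left h)]

/-- The Kraft inequality for finite prefix-free sets of binary strings. -/
theorem kraft_of_prefixFree (S : Finset (List Bool))
    (hS : ∀ p ∈ S, ∀ q ∈ S, p <+: q → p = q) : ∑ p ∈ S, ((2 : ℝ) ^ p.length)⁻¹ ≤ 1 := by
  by_cases hnil : [] ∈ S
  · have : S = {[]} := Finset.eq_singleton_iff_unique_mem.2
      ⟨hnil, fun q hq => (hS [] hnil q hq (List.nil_prefix)).symm⟩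
    simp [this]
  · have := InformationTheory.kraft_mcmillan_inequality (S := S)
      (uniquelyDecodable_of_prefixFree (by simpa using hnil) (by simpa using hS))
    simpa using this

/-! ### Dyadic intervals of binary strings -/

/-- The number with binary expansion `p`, most significant bit first. The string `p` stands for the
interval `[binVal p / 2 ^ |p|, (binVal p + 1) / 2 ^ |p|)` of all reals whose expansion begins
with `p`. -/
def binVal (p : List Bool) : ℕ := p.foldl (fun n b => 2 * n + b.toNat) 0

theorem foldl_binVal (t : List Bool) (a : ℕ) :
    t.foldl (fun n b => 2 * n + b.toNat) a = a * 2 ^ t.length + binVal t := by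
  induction t generalizing a with
  | nil => simp [binVal]
  | cons b t ih =>
    simp only [binVal, List.foldl_cons, List.length_cons] at *
    rw [ih, ih (2 * 0 + b.toNat)]
    ring

theorem binVal_append (p t : List Bool) :
    binVal (p ++ t) = binVal p * 2 ^ t.length + binVal t := by
  rw [binVal, List.foldl_append, foldl_binVal]
  rfl

theorem binVal_lt (t : List Bool) : binVal t < 2 ^ t.length := by
  induction t with
  | nil => simp [binVal]
  | cons b t ih =>
    have h := foldl_binVal t (2 * 0 + b.toNat)
    have hb : b.toNat ≤ 1 := Bool.toNat_le b
    have : binVal (b :: t) = b.toNat * 2 ^ t.length + binVal t := by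
      rw [binVal, List.foldl_cons, h]; simp
    rw [this, List.length_cons, pow_succ]
    nlinarith [Nat.one_le_two_pow (n := t.length)]

theorem exists_binVal_eq (l j : ℕ) (hj : j < 2 ^ l) :
    ∃ p : List Bool, p.length = l ∧ binVal p = j := by
  induction l generalizing j with
  | zero => exact ⟨[], rfl, by simp at hj; simp [binVal, hj]⟩
  | succ l ih =>
    obtain ⟨p, hp, hv⟩ := ih (j / 2) (by rw [pow_succ] at hj; omega)
    refine ⟨p ++ [decide (j % 2 = 1)], by simp [hp], ?_⟩
    rw [binVal_append, hv]
    rcases Nat.mod_two_eq_zero_or_one j with h | h <;> simp [binVal, h] <;> omega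

theorem primrec_binVal : Primrec binVal := by
  refine Primrec.list_foldl (α := List Bool) (f := id)
    (h := fun _ s => 2 * s.1 + s.2.toNat) Primrec.id (Primrec.const 0) ?_
  have hb : Primrec Bool.toNat := Primrec.dom_bool _
  exact (Primrec.nat_add.comp (Primrec.nat_mul.comp (Primrec.const 2)
    (Primrec.fst.comp Primrec.snd)) (hb.comp (Primrec.snd.comp Primrec.snd))).to₂

theorem primrec_two_pow : Primrec fun n : ℕ => 2 ^ n :=
  (Primrec₂.unpaired'.1 Nat.Primrec.pow).comp (Primrec.const 2) Primrec.id

/-- The dyadic interval of an extension is a subinterval. -/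
theorem binVal_div_le_of_prefix {p q : List Bool} (h : p <+: q) :
    (binVal p : ℝ) / 2 ^ p.length ≤ binVal q / 2 ^ q.length ∧
      ((binVal q : ℝ) + 1) / 2 ^ q.length ≤ (binVal p + 1) / 2 ^ p.length := by
  obtain ⟨t, rfl⟩ := h
  have ht : (binVal t : ℝ) + 1 ≤ 2 ^ t.length := by exact_mod_cast binVal_lt t
  rw [binVal_append, List.length_append, pow_add]
  push_cast
  constructor
  · rw [div_le_div_iff₀ (by positivity) (by positivity)]
    have : (0 : ℝ) ≤ binVal t * 2 ^ p.length := by positivity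
    nlinarith
  · rw [div_le_div_iff₀ (by positivity) (by positivity)]
    have : (0 : ℝ) ≤ 2 ^ p.length := by positivity
    nlinarith

/-- An interval of length `2 ^ (-l)` inside `[0, 1]` contains the dyadic interval of a string of
length `l + 1`. -/
theorem exists_dyadic_subset (s : ℝ) (l : ℕ) (h0 : 0 ≤ s) (h1 : s + ((2 : ℝ) ^ l)⁻¹ ≤ 1) :
    ∃ p : List Bool, p.length = l + 1 ∧ s ≤ (binVal p : ℝ) / 2 ^ (l + 1) ∧
      ((binVal p : ℝ) + 1) / 2 ^ (l + 1) ≤ s + ((2 : ℝ) ^ l)⁻¹ := by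
  -- The first multiple of `2 ^ (-(l + 1))` from `s` on lies less than `2 ^ (-(l + 1))` beyond `s`.
  have hpos : (0 : ℝ) < 2 ^ (l + 1) := by positivity
  have hceil := Nat.ceil_lt_add_one (mul_nonneg h0 hpos.le)
  have hle := Nat.le_ceil (s * 2 ^ (l + 1))
  have he : (s + ((2 : ℝ) ^ l)⁻¹) * 2 ^ (l + 1) = s * 2 ^ (l + 1) + 2 := by
    rw [pow_succ]; field_simp
  have hj : ((⌈s * 2 ^ (l + 1)⌉₊ : ℕ) : ℝ) + 1 ≤ (s + ((2 : ℝ) ^ l)⁻¹) * 2 ^ (l + 1) := by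
    rw [he]; linarith
  obtain ⟨p, hp, hv⟩ := exists_binVal_eq (l + 1) ⌈s * 2 ^ (l + 1)⌉₊ (by
    have : ((⌈s * 2 ^ (l + 1)⌉₊ : ℕ) : ℝ) + 1 ≤ ((2 ^ (l + 1) : ℕ) : ℝ) := by
      push_cast
      nlinarith
    exact_mod_cast this)
  refine ⟨p, hp, ?_, ?_⟩
  · rw [hv, le_div_iff₀ hpos]; exact hle
  · rw [hv, div_le_iff₀ hpos]; exact hj

/-! ### Programs on a universal machine -/

theorem condK_le_length {α β : Type} [Primcodable α] [Primcodable β] {x : α} {y : β}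
    {p : List Bool} (hp : p ∈ programs U x y) : condK U x y ≤ p.length :=
  Nat.sInf_le ⟨p, hp, rfl⟩

theorem exists_program_length_eq (hU : IsUniversalPrefixMachine U) {α β : Type} [Primcodable α]
    [Primcodable β] (x : α) (y : β) : ∃ p ∈ programs U x y, p.length = condK U x y :=
  Nat.sInf_mem ((programs_nonempty hU x y).image _)

theorem condK_encode {α β : Type} [Primcodable α] [Primcodable β] (x : α) (y : β) :
    condK U (encode x) (encode y) = condK U x y := rfl

theorem K_eq_condK_zero {α : Type} [Primcodable α] (x : α) : K U x = condK U (encode x) 0 := rfl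

theorem star_mem (hU : IsUniversalPrefixMachine U) {α : Type} [Primcodable α] (x : α) :
    encode x ∈ U (star U x) 0 := by
  have h := programs_nonempty hU x ([] : List Bool)
  rw [star, dif_pos h]
  exact WellFounded.min_mem (List.Shortlex.wf wellFounded_lt) _ h

theorem length_star (hU : IsUniversalPrefixMachine U) {α : Type} [Primcodable α] (x : α) :
    (star U x).length = K U x := by
  refine le_antisymm ?_ (condK_le_length (star_mem hU x))
  obtain ⟨p, hp, hl⟩ := exists_program_length_eq hU x ([] : List Bool)
  rw [K, ← hl]
  by_contra! hlt
  have h := programs_nonempty hU x ([] : List Bool)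
  rw [star, dif_pos h] at hlt
  exact WellFounded.not_lt_min (List.Shortlex.wf wellFounded_lt) _ hp
    (List.Shortlex.of_length_lt hlt)

/-- The invariance theorem: universal programs are no longer than those of any other prefix
machine, up to a constant. -/
theorem exists_condK_le_of_machine (hU : IsUniversalPrefixMachine U) {T : List Bool → ℕ →. ℕ}
    (hT : IsPrefixMachine T) :
    ∃ k : ℕ, ∀ (p : List Bool) (c n : ℕ), n ∈ T p c → condK U n c ≤ p.length + k := by
  obtain ⟨k, hk⟩ := hU.simulates T hT
  refine ⟨k, fun p c n hn => ?_⟩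
  obtain ⟨q, hq, hl⟩ := hk p c n hn
  exact (condK_le_length (x := n) (y := c) hq).trans hl

theorem m_pos {α β : Type} [Primcodable α] [Primcodable β] (x : α) (y : β) : 0 < m U x y := by
  unfold m; positivity

/-- The universal probabilities of distinct objects add up to at most one: shortest programs of
distinct objects form a prefix-free set. -/
theorem sum_m_le_one (hU : IsUniversalPrefixMachine U) {α β : Type} [Primcodable α]
    [Primcodable β] (y : β) (F : Finset α) : ∑ x ∈ F, m U x y ≤ 1 := by
  classical
  choose p hp hl using fun x : α => exists_program_length_eq hU x y
  have hinj : Function.Injective p := fun a b hab => by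
    have hb := hp b
    rw [← hab] at hb
    exact Encodable.encode_injective (Part.mem_unique (hp a) hb)
  have h := kraft_of_prefixFree (F.image p) (by
    intro u hu v hv huv
    obtain ⟨a, -, rfl⟩ := Finset.mem_image.1 hu
    obtain ⟨b, -, rfl⟩ := Finset.mem_image.1 hv
    exact hU.prefix_free _ _ _ (Part.dom_iff_mem.2 ⟨_, hp a⟩) (Part.dom_iff_mem.2 ⟨_, hp b⟩) huv)
  rw [Finset.sum_image hinj.injOn] at h
  refine le_of_eq_of_le (Finset.sum_congr rfl fun x _ => ?_) h
  rw [hl, m, zpow_neg, zpow_natCast]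

/-! ### From enumerated requests to a prefix machine -/

/-- A request sequence assigns to a condition `c` and a stage `i` at most one request `(l, n)`,
which asks for a program of length about `l` that computes `n` from `c`. Its measure is
`2 ^ (-l)`. -/
abbrev Requests := ℕ → ℕ → Option (ℕ × ℕ)

/-- The measure of the request at stage `i`, in units of `2 ^ (-(i + 1))`. The subtraction is exact
for the requests of interest, those with `l ≤ i + 1`. -/
def scaledWeight (i : ℕ) (r : Option (ℕ × ℕ)) : ℕ :=
  r.casesOn 0 fun r => 2 ^ (i + 1 - r.1)

/-- The total measure of the requests before stage `i`, in units of `2 ^ (-i)`. -/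
def scaledPos (R : Requests) (c i : ℕ) : ℕ :=
  Nat.rec (motive := fun _ => ℕ) 0 (fun j A => 2 * A + scaledWeight j (R c j)) i

/-- The total measure of the requests before stage `i`. The request at stage `i` is given the
interval from `pos R c i` to `pos R c (i + 1)`. -/
noncomputable def pos (R : Requests) (c i : ℕ) : ℝ := scaledPos R c i / 2 ^ i

/-- The measure of a request. -/
noncomputable def weight (r : Option (ℕ × ℕ)) : ℝ := r.casesOn 0 fun r => ((2 : ℝ) ^ r.1)⁻¹

theorem pos_succ' (R : Requests) (c i : ℕ) :
    pos R c (i + 1) = pos R c i + scaledWeight i (R c i) / 2 ^ (i + 1) := by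
  have : scaledPos R c (i + 1) = 2 * scaledPos R c i + scaledWeight i (R c i) := rfl
  rw [pos, pos, this, pow_succ]
  push_cast
  field_simp

theorem monotone_pos (R : Requests) (c : ℕ) : Monotone (pos R c) :=
  monotone_nat_of_le_succ fun i => by
    rw [pos_succ']
    have : (0 : ℝ) ≤ scaledWeight i (R c i) / 2 ^ (i + 1) := by positivity
    linarith

theorem pos_nonneg (R : Requests) (c i : ℕ) : 0 ≤ pos R c i := by
  unfold pos; positivity

theorem pos_succ {R : Requests} {c : ℕ} (hR : ∀ i l n, R c i = some (l, n) → l ≤ i + 1) (i : ℕ) :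
    pos R c (i + 1) = pos R c i + weight (R c i) := by
  rw [pos_succ']
  rcases h : R c i with _ | ⟨l, n⟩
  · simp [scaledWeight, weight]
  · have hl := hR i l n h
    obtain ⟨d, hd⟩ := Nat.exists_eq_add_of_le hl
    have : i + 1 - l = d := by omega
    simp only [scaledWeight, weight, this]
    rw [hd, pow_add]
    push_cast
    field_simp

theorem pos_eq_sum {R : Requests} {c : ℕ} (hR : ∀ i l n, R c i = some (l, n) → l ≤ i + 1)
    (i : ℕ) : pos R c i = ∑ j ∈ Finset.range i, weight (R c j) := by
  induction i with
  | zero => simp [pos, scaledPos]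
  | succ i ih => rw [pos_succ hR, ih, Finset.sum_range_succ]

/-- Decides whether `p` has length `l + 1` and its dyadic interval lies between `A / 2 ^ i` and
`B / 2 ^ (i + 1)`. -/
def fits (i A B l : ℕ) (p : List Bool) : Bool :=
  decide (p.length = l + 1) && (decide (A * 2 ^ p.length ≤ binVal p * 2 ^ i) &&
    decide ((binVal p + 1) * 2 ^ (i + 1) ≤ B * 2 ^ p.length))

/-- `p` is a code word for the request at stage `i`. -/
def IsCodeword (R : Requests) (c i : ℕ) (p : List Bool) : Prop :=
  ∃ l n, R c i = some (l, n) ∧ p.length = l + 1 ∧ pos R c i ≤ (binVal p : ℝ) / 2 ^ p.length ∧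
    ((binVal p : ℝ) + 1) / 2 ^ p.length ≤ pos R c (i + 1)

theorem fits_iff (R : Requests) (c i l : ℕ) (p : List Bool) :
    fits i (scaledPos R c i) (scaledPos R c (i + 1)) l p = true ↔
      p.length = l + 1 ∧ pos R c i ≤ (binVal p : ℝ) / 2 ^ p.length ∧
        ((binVal p : ℝ) + 1) / 2 ^ p.length ≤ pos R c (i + 1) := by
  simp only [fits, Bool.and_eq_true, decide_eq_true_eq, pos]
  rw [div_le_div_iff₀ (by positivity) (by positivity),
    div_le_div_iff₀ (by positivity) (by positivity)]
  norm_cast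

/-- The intervals of distinct stages do not overlap, so no code word for one stage extends a code
word for another. -/
theorem IsCodeword.stage_eq {R : Requests} {c i j : ℕ} {p q : List Bool}
    (hp : IsCodeword R c i p) (hq : IsCodeword R c j q) (hpq : p <+: q) : i = j := by
  obtain ⟨-, -, -, -, hp1, hp2⟩ := hp
  obtain ⟨-, -, -, -, hq1, hq2⟩ := hq
  obtain ⟨h1, h2⟩ := binVal_div_le_of_prefix hpq
  have hlt : (binVal q : ℝ) / 2 ^ q.length < ((binVal q : ℝ) + 1) / 2 ^ q.length := by
    gcongr; linarith
  rcases lt_trichotomy i j with h | h | h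
  · have := monotone_pos R c (show i + 1 ≤ j from h)
    linarith
  · exact h
  · have := monotone_pos R c (show j + 1 ≤ i from h)
    linarith

theorem IsCodeword.eq_of_prefix {R : Requests} {c i j : ℕ} {p q : List Bool}
    (hp : IsCodeword R c i p) (hq : IsCodeword R c j q) (hpq : p <+: q) : p = q := by
  obtain rfl := hp.stage_eq hq hpq
  obtain ⟨l, n, hr, hl, -⟩ := hp
  obtain ⟨l', n', hr', hl', -⟩ := hq
  rw [hr] at hr'
  simp only [Option.some.injEq, Prod.mk.injEq] at hr'
  exact hpq.eq_of_length (by omega)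

/-- The output at stage `i` of the machine that serves the requests `R`. -/
def stageOutput (R : Requests) (p : List Bool) (c i : ℕ) : Option ℕ :=
  (R c i).bind fun r =>
    bif fits i (scaledPos R c i) (scaledPos R c (i + 1)) r.1 p then some r.2 else none

theorem stageOutput_eq_some {R : Requests} {p : List Bool} {c i n : ℕ} :
    stageOutput R p c i = some n ↔ IsCodeword R c i p ∧ ∃ l, R c i = some (l, n) := by
  unfold stageOutput IsCodeword
  rcases R c i with _ | ⟨l, v⟩
  · simp
  · rw [Option.bind_some]
    cases h : fits i (scaledPos R c i) (scaledPos R c (i + 1)) l p with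
    | true =>
      have hfit := (fits_iff R c i l p).1 h
      simp only [cond_true, Option.some.injEq, Prod.mk.injEq, exists_eq_left']
      exact ⟨fun hv => ⟨⟨l, v, ⟨rfl, rfl⟩, hfit⟩, hv⟩, fun hv => hv.2⟩
    | false =>
      have := mt (fits_iff R c i l p).2 (by simp [h])
      simp only [cond_false, reduceCtorEq, false_iff]
      rintro ⟨⟨l', n', hr, hh⟩, -⟩
      simp only [Option.some.injEq, Prod.mk.injEq] at hr
      exact this (hr.1 ▸ hh)

theorem computable_scaledPos {R : Requests} (hR : Computable₂ R) :
    Computable₂ (scaledPos R) := by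
  have hw : Primrec fun a : ℕ × Option (ℕ × ℕ) => scaledWeight a.1 a.2 :=
    Primrec.option_casesOn Primrec.snd (Primrec.const 0)
      (primrec_two_pow.comp (Primrec.nat_sub.comp
        (Primrec.succ.comp (Primrec.fst.comp Primrec.fst)) (Primrec.fst.comp Primrec.snd))).to₂
  have hs : Primrec fun a : ℕ × ℕ × Option (ℕ × ℕ) => 2 * a.1 + scaledWeight a.2.1 a.2.2 :=
    Primrec.nat_add.comp (Primrec.nat_double.comp Primrec.fst) (hw.comp Primrec.snd)
  have hj : Computable fun b : (ℕ × ℕ) × ℕ × ℕ => b.2.1 := Computable.fst.comp Computable.snd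
  have hA : Computable fun b : (ℕ × ℕ) × ℕ × ℕ => b.2.2 := Computable.snd.comp Computable.snd
  have hr : Computable fun b : (ℕ × ℕ) × ℕ × ℕ => R b.1.1 b.2.1 :=
    hR.comp (Computable.fst.comp Computable.fst) hj
  have hstep := hs.to_comp.comp (hA.pair (hj.pair hr))
  exact Computable.nat_rec (f := fun a : ℕ × ℕ => a.2) (g := fun _ => 0)
    Computable.snd (Computable.const 0) hstep.to₂

theorem primrec_fits :
    Primrec fun a : (ℕ × ℕ × ℕ) × ℕ × List Bool => fits a.1.1 a.1.2.1 a.1.2.2 a.2.1 a.2.2 := by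
  have hi : Primrec fun a : (ℕ × ℕ × ℕ) × ℕ × List Bool => a.1.1 := Primrec.fst.comp Primrec.fst
  have hA : Primrec fun a : (ℕ × ℕ × ℕ) × ℕ × List Bool => a.1.2.1 :=
    Primrec.fst.comp (Primrec.snd.comp Primrec.fst)
  have hB : Primrec fun a : (ℕ × ℕ × ℕ) × ℕ × List Bool => a.1.2.2 :=
    Primrec.snd.comp (Primrec.snd.comp Primrec.fst)
  have hl : Primrec fun a : (ℕ × ℕ × ℕ) × ℕ × List Bool => a.2.1 := Primrec.fst.comp Primrec.snd
  have hp : Primrec fun a : (ℕ × ℕ × ℕ) × ℕ × List Bool => a.2.2 := Primrec.snd.comp Primrec.snd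
  have hlen := Primrec.list_length.comp hp
  refine Primrec.and.comp ?_ (Primrec.and.comp ?_ ?_)
  · exact (Primrec.eq.comp hlen (Primrec.succ.comp hl)).decide
  · exact (Primrec.nat_le.comp (Primrec.nat_mul.comp hA (primrec_two_pow.comp hlen))
      (Primrec.nat_mul.comp (primrec_binVal.comp hp) (primrec_two_pow.comp hi))).decide
  · exact (Primrec.nat_le.comp (Primrec.nat_mul.comp (Primrec.succ.comp (primrec_binVal.comp hp))
      (primrec_two_pow.comp (Primrec.succ.comp hi)))
      (Primrec.nat_mul.comp hB (primrec_two_pow.comp hlen))).decide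

theorem computable_stageOutput {R : Requests} (hR : Computable₂ R) :
    Computable fun a : (List Bool × ℕ) × ℕ => stageOutput R a.1.1 a.1.2 a.2 := by
  have hc : Computable fun a : (List Bool × ℕ) × ℕ => a.1.2 := Computable.snd.comp Computable.fst
  have hi : Computable fun a : (List Bool × ℕ) × ℕ => a.2 := Computable.snd
  have hS := computable_scaledPos hR
  have hr : Computable fun b : ((List Bool × ℕ) × ℕ) × ℕ × ℕ => b.2 := Computable.snd
  have hf := primrec_fits.to_comp.comp
    (((hi.pair ((hS.comp hc hi).pair (hS.comp hc (Computable.succ.comp hi)))).comp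
      (Computable.fst (α := (List Bool × ℕ) × ℕ) (β := ℕ × ℕ))).pair
      ((Computable.fst.comp hr).pair
        (Computable.fst.comp (Computable.fst.comp Computable.fst))))
  exact Computable.option_bind (hR.comp hc hi) (Computable.cond hf
    (Computable.option_some.comp (Computable.snd.comp hr)) (Computable.const none)).to₂

/-- The machine that serves the requests `R`: its programs are the code words of the requests.
It is a prefix machine whether or not the measures of the requests add up to at most one, since
the intervals of the requests are disjoint and code words represent subintervals of `[0, 1]`. -/
def requestMachine (R : Requests) (p : List Bool) (c : ℕ) : Part ℕ :=
  Nat.rfindOpt (stageOutput R p c)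

theorem isPrefixMachine_requestMachine {R : Requests} (hR : Computable₂ R) :
    IsPrefixMachine (requestMachine R) := by
  refine ⟨Partrec.rfindOpt (computable_stageOutput hR).to₂, fun c p q hp hq hpq => ?_⟩
  obtain ⟨i, v, hv⟩ := Nat.rfindOpt_dom.1 hp
  obtain ⟨j, w, hw⟩ := Nat.rfindOpt_dom.1 hq
  exact (stageOutput_eq_some.1 hv).1.eq_of_prefix (stageOutput_eq_some.1 hw).1 hpq

/-- An effective Kraft-Chaitin theorem, for all conditions at once: at each condition where the
total measure of the requests is at most one, they are served up to a constant. The bound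
`l ≤ i + 1` lets the positions before stage `i` be multiples of `2 ^ (-i)`. -/
theorem exists_condK_le_of_requests (hU : IsUniversalPrefixMachine U)
    {R : Requests} (hR : Computable₂ R) :
    ∃ k : ℕ, ∀ c, (∀ i l n, R c i = some (l, n) → l ≤ i + 1) →
      (∀ N, ∑ i ∈ Finset.range N, weight (R c i) ≤ 1) →
      ∀ i l n, R c i = some (l, n) → condK U n c ≤ l + k := by
  obtain ⟨k, hk⟩ := exists_condK_le_of_machine hU (isPrefixMachine_requestMachine hR)
  refine ⟨k + 1, fun c hl hsum i l n hr => ?_⟩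
  have hs := pos_succ hl i
  have h1 : pos R c (i + 1) ≤ 1 := by rw [pos_eq_sum hl]; exact hsum _
  rw [hr] at hs
  simp only [weight] at hs
  obtain ⟨p, hp, hp1, hp2⟩ := exists_dyadic_subset (pos R c i) l (pos_nonneg R c i) (by linarith)
  rw [← hp] at hp1 hp2
  have hcw : IsCodeword R c i p := ⟨l, n, hr, hp, hp1, by rw [hs]; exact hp2⟩
  have hout : n ∈ requestMachine R p c := by
    have hi := stageOutput_eq_some.2 ⟨hcw, l, hr⟩
    obtain ⟨v, hv⟩ := Part.dom_iff_mem.1 (Nat.rfindOpt_dom.2 ⟨i, n, hi⟩)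
    obtain ⟨j, hj⟩ := Nat.rfindOpt_spec hv
    obtain ⟨hcw', l', hr'⟩ := stageOutput_eq_some.1 hj
    rw [← hcw.stage_eq hcw' (List.prefix_refl p), hr] at hr'
    simp only [Option.some.injEq, Prod.mk.injEq] at hr'
    rw [hr'.2]
    exact hv
  have := hk p c n hout
  omega

/-! ### The coding theorem -/

/-- The value of a fraction `numerator / denominator`, zero if the denominator is zero. -/
noncomputable def fracVal (r : ℕ × ℕ) : ℝ := (r.1 : ℝ) / r.2

theorem fracVal_nonneg (r : ℕ × ℕ) : 0 ≤ fracVal r := by unfold fracVal; positivity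

/-- Decides whether a fraction is at least `2 ^ (-k)`. -/
def reaches (r : ℕ × ℕ) (k : ℕ) : Bool := decide (0 < r.2) && decide (r.2 ≤ r.1 * 2 ^ k)

theorem reaches_iff {r : ℕ × ℕ} {k : ℕ} :
    reaches r k = true ↔ ((2 : ℝ) ^ k)⁻¹ ≤ fracVal r := by
  obtain ⟨a, b⟩ := r
  simp only [reaches, fracVal, Bool.and_eq_true, decide_eq_true_eq]
  rcases Nat.eq_zero_or_pos b with rfl | hb
  · simp
  · have hb' : (0 : ℝ) < b := by exact_mod_cast hb
    rw [inv_eq_one_div, div_le_div_iff₀ (by positivity) hb', one_mul]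
    simp only [hb, true_and]
    norm_cast

theorem primrec_reaches : Primrec₂ reaches := by
  have hr : Primrec fun a : (ℕ × ℕ) × ℕ => a.1.2 := Primrec.snd.comp Primrec.fst
  refine Primrec.and.comp (Primrec.nat_lt.comp (Primrec.const 0) hr).decide ?_
  exact (Primrec.nat_le.comp hr (Primrec.nat_mul.comp (Primrec.fst.comp Primrec.fst)
    (primrec_two_pow.comp Primrec.snd))).decide

/-- Given the approximations `u t` of a number from below, decides whether `t` is the first time at
which `2 ^ (-k)` is reached. -/
def firstReaches (u : ℕ → ℕ × ℕ) (k t : ℕ) : Bool :=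
  reaches (u t) k && (decide (t = 0) || !reaches (u (t - 1)) k)

/-- Stage `⟨n, k, t⟩` requests a program of length about `k + 1` for `n` if `t` is the first time
at which the approximations `φ (c, n)` reach `2 ^ (-k)`. -/
def codingRequests (φ : ℕ × ℕ → ℕ → ℕ × ℕ) : Requests := fun c i =>
  bif firstReaches (φ (c, i.unpair.1)) i.unpair.2.unpair.1 i.unpair.2.unpair.2 then
    some (i.unpair.2.unpair.1 + 1, i.unpair.1) else none

theorem computable_codingRequests {φ : ℕ × ℕ → ℕ → ℕ × ℕ} (hφ : Computable₂ φ) :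
    Computable₂ (codingRequests φ) := by
  have hu : Primrec fun a : ℕ × ℕ => a.2.unpair := Primrec.unpair.comp Primrec.snd
  have hu' : Primrec fun a : ℕ × ℕ => a.2.unpair.2.unpair :=
    Primrec.unpair.comp (Primrec.snd.comp hu)
  have hn : Primrec fun a : ℕ × ℕ => a.2.unpair.1 := Primrec.fst.comp hu
  have hk : Primrec fun a : ℕ × ℕ => a.2.unpair.2.unpair.1 := Primrec.fst.comp hu'
  have ht : Primrec fun a : ℕ × ℕ => a.2.unpair.2.unpair.2 := Primrec.snd.comp hu'
  have hcn : Primrec fun a : ℕ × ℕ => (a.1, a.2.unpair.1) := Primrec.fst.pair hn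
  have hr : Computable₂ reaches := primrec_reaches.to_comp
  have hb : Computable fun a : ℕ × ℕ => firstReaches (φ (a.1, a.2.unpair.1))
      a.2.unpair.2.unpair.1 a.2.unpair.2.unpair.2 :=
    Primrec.and.to_comp.comp (hr.comp (hφ.comp hcn.to_comp ht.to_comp) hk.to_comp)
      (Primrec.or.to_comp.comp (Primrec.eq.comp ht (Primrec.const 0)).decide.to_comp
        (Primrec.not.to_comp.comp
          (hr.comp (hφ.comp hcn.to_comp (Primrec.pred.comp ht).to_comp) hk.to_comp)))
  exact Computable.cond hb
    (Primrec.option_some.comp ((Primrec.succ.comp hk).pair hn)).to_comp (Computable.const none)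

theorem exists_firstReaches {u : ℕ → ℕ × ℕ} {k t : ℕ} (h : reaches (u t) k = true) :
    ∃ s, firstReaches u k s = true := by
  classical
  have hex : ∃ s, reaches (u s) k = true := ⟨t, h⟩
  refine ⟨Nat.find hex, ?_⟩
  simp only [firstReaches, Bool.and_eq_true, Bool.or_eq_true, decide_eq_true_eq,
    Bool.not_eq_true']
  refine ⟨Nat.find_spec hex, ?_⟩
  rcases Nat.eq_zero_or_pos (Nat.find hex) with h0 | h0
  · exact Or.inl h0
  · exact Or.inr (by simpa using Nat.find_min hex (show Nat.find hex - 1 < Nat.find hex by omega))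

/-- For each `k` there is at most one first time. -/
theorem sum_firstReaches_le {u : ℕ → ℕ × ℕ} (hu : Monotone fun t => fracVal (u t)) (k N : ℕ)
    (x : ℝ) :
    ∑ t ∈ Finset.range (N + 1), (if firstReaches u k t = true then x else 0) ≤
      if reaches (u N) k = true then x else 0 := by
  induction N with
  | zero => simp [firstReaches]
  | succ N ih =>
    rw [Finset.sum_range_succ]
    have hmono : reaches (u N) k = true → reaches (u (N + 1)) k = true := fun h =>
      reaches_iff.2 ((reaches_iff.1 h).trans (hu (Nat.le_succ N)))
    cases h : reaches (u N) k with
    | true =>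
      rw [h] at ih
      simpa [firstReaches, h, hmono h] using ih
    | false =>
      rw [h] at ih
      have hfirst : firstReaches u k (N + 1) = reaches (u (N + 1)) k := by
        simp [firstReaches, h]
      rw [hfirst]
      simpa using ih

/-- For `q > 0` the sum consists of the terms `2 ^ (-(k + 1))` from some `k` on. The bound by one is
needed for the induction, which passes from `q` to `2 * q`. -/
theorem sum_dyadic_below_le (N : ℕ) (q : ℝ) (hq : 0 ≤ q) :
    ∑ k ∈ Finset.range N, (if ((2 : ℝ) ^ k)⁻¹ ≤ q then ((2 : ℝ) ^ (k + 1))⁻¹ else 0) ≤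
      min q 1 := by
  induction N generalizing q with
  | zero => simp [hq]
  | succ N ih =>
    rw [Finset.sum_range_succ']
    have hstep : ∀ k : ℕ,
        (if ((2 : ℝ) ^ (k + 1))⁻¹ ≤ q then ((2 : ℝ) ^ (k + 1 + 1))⁻¹ else 0) =
          (if ((2 : ℝ) ^ k)⁻¹ ≤ 2 * q then ((2 : ℝ) ^ (k + 1))⁻¹ else 0) * 2⁻¹ := by
      intro k
      have hiff : ((2 : ℝ) ^ (k + 1))⁻¹ ≤ q ↔ ((2 : ℝ) ^ k)⁻¹ ≤ 2 * q := by
        rw [pow_succ, mul_inv]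
        constructor <;> intro h <;> linarith
      simp only [hiff]
      split_ifs
      · rw [pow_succ _ (k + 1), mul_inv]
      · simp
    simp only [hstep]
    rw [← Finset.sum_mul]
    have h2 := ih (2 * q) (by linarith)
    have h3 := h2.trans (min_le_left _ _)
    have h4 := h2.trans (min_le_right _ _)
    refine le_min ?_ ?_
    · split_ifs with h
      · norm_num at h ⊢; linarith
      · linarith
    · split_ifs <;> norm_num <;> linarith

theorem weight_codingRequests (φ : ℕ × ℕ → ℕ → ℕ × ℕ) (c i : ℕ) :
    weight (codingRequests φ c i) =
      if firstReaches (φ (c, i.unpair.1)) i.unpair.2.unpair.1 i.unpair.2.unpair.2 = true then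
        ((2 : ℝ) ^ (i.unpair.2.unpair.1 + 1))⁻¹ else 0 := by
  unfold codingRequests
  cases firstReaches (φ (c, i.unpair.1)) i.unpair.2.unpair.1 i.unpair.2.unpair.2 <;> simp [weight]

/-- For each `n` the requests have total measure at most the value approximated. -/
theorem sum_weight_codingRequests_le {φ : ℕ × ℕ → ℕ → ℕ × ℕ} {c : ℕ}
    (hmono : ∀ n, Monotone fun t => fracVal (φ (c, n) t)) (N : ℕ) :
    ∑ i ∈ Finset.range N, weight (codingRequests φ c i) ≤
      ∑ n ∈ Finset.range N, fracVal (φ (c, n) N) := by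
  let w : ℕ × ℕ × ℕ → ℝ := fun a =>
    if firstReaches (φ (c, a.1)) a.2.1 a.2.2 = true then ((2 : ℝ) ^ (a.2.1 + 1))⁻¹ else 0
  let e : ℕ → ℕ × ℕ × ℕ := fun i => (i.unpair.1, i.unpair.2.unpair.1, i.unpair.2.unpair.2)
  have he : Function.Injective e := fun i j hij => by
    simp only [e, Prod.mk.injEq] at hij
    have h2 : i.unpair.2 = j.unpair.2 := by
      rw [← Nat.pair_unpair i.unpair.2, ← Nat.pair_unpair j.unpair.2, hij.2.1, hij.2.2]
    rw [← Nat.pair_unpair i, ← Nat.pair_unpair j, hij.1, h2]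
  have hw : ∀ a, 0 ≤ w a := fun a => by
    simp only [w]; split_ifs <;> positivity
  calc ∑ i ∈ Finset.range N, weight (codingRequests φ c i)
      = ∑ i ∈ Finset.range N, w (e i) :=
        Finset.sum_congr rfl fun i _ => weight_codingRequests φ c i
    _ = ∑ a ∈ (Finset.range N).image e, w a := (Finset.sum_image he.injOn).symm
    _ ≤ ∑ a ∈ Finset.range N ×ˢ Finset.range N ×ˢ Finset.range (N + 1), w a := by
        refine Finset.sum_le_sum_of_subset_of_nonneg ?_ fun a _ _ => hw a
        intro a ha
        obtain ⟨i, hi, rfl⟩ := Finset.mem_image.1 ha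
        have h1 := Nat.unpair_left_le i
        have h2 := Nat.unpair_right_le i
        have h3 := Nat.unpair_left_le i.unpair.2
        have h4 := Nat.unpair_right_le i.unpair.2
        simp only [Finset.mem_range] at hi
        simp only [e, Finset.mem_product, Finset.mem_range]
        omega
    _ = ∑ n ∈ Finset.range N, ∑ k ∈ Finset.range N, ∑ t ∈ Finset.range (N + 1), w (n, k, t) := by
        simp only [Finset.sum_product]
    _ ≤ ∑ n ∈ Finset.range N, fracVal (φ (c, n) N) := by
        refine Finset.sum_le_sum fun n _ => ?_
        refine (Finset.sum_le_sum fun k _ =>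
          sum_firstReaches_le (hmono n) k N ((2 : ℝ) ^ (k + 1))⁻¹).trans ?_
        simp only [reaches_iff]
        exact (sum_dyadic_below_le N _ (fracVal_nonneg _)).trans (min_le_left _ _)

theorem inv_two_pow_le_m {α β : Type} [Primcodable α] [Primcodable β]
    {x : α} {y : β} {l : ℕ} (h : condK U x y ≤ l) : ((2 : ℝ) ^ l)⁻¹ ≤ m U x y := by
  rw [m, zpow_neg, zpow_natCast]
  gcongr
  norm_num

/-- The coding theorem, for approximations from below. The constant depends on neither the
condition `c`, nor on whether the approximations at other conditions form semimeasures. -/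
theorem exists_fracVal_le_m (hU : IsUniversalPrefixMachine U)
    {φ : ℕ × ℕ → ℕ → ℕ × ℕ} (hφ : Computable₂ φ) :
    ∃ k : ℕ, ∀ c, (∀ n, Monotone fun t => fracVal (φ (c, n) t)) →
      (∀ N, ∑ n ∈ Finset.range N, fracVal (φ (c, n) N) ≤ 1) →
      ∀ n t, fracVal (φ (c, n) t) ≤ 2 ^ k * m U n c := by
  obtain ⟨k, hk⟩ := exists_condK_le_of_requests hU (computable_codingRequests hφ)
  refine ⟨k + 2, fun c hmono hsum n t => ?_⟩
  have hK := hk c (fun i l v hr => by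
    unfold codingRequests at hr
    have h1 := Nat.unpair_right_le i
    have h2 := Nat.unpair_left_le i.unpair.2
    rw [Bool.cond_eq_ite] at hr
    split_ifs at hr
    simp only [Option.some.injEq, Prod.mk.injEq] at hr
    omega) fun N => (sum_weight_codingRequests_le hmono N).trans (hsum N)
  rcases (fracVal_nonneg (φ (c, n) t)).eq_or_lt with h0 | h0
  · rw [← h0]
    exact mul_nonneg (by positivity) (m_pos _ _).le
  -- The sum at stage `N` runs over `n < N` only, hence the passage to a later stage.
  have hle : fracVal (φ (c, n) t) ≤ 1 :=
    calc fracVal (φ (c, n) t) ≤ fracVal (φ (c, n) (max (n + 1) t)) := hmono n (le_max_right _ _)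
      _ ≤ ∑ v ∈ Finset.range (max (n + 1) t), fracVal (φ (c, v) (max (n + 1) t)) :=
          Finset.single_le_sum (f := fun v => fracVal (φ (c, v) (max (n + 1) t)))
            (fun v _ => fracVal_nonneg _) (Finset.mem_range.2 (by omega))
      _ ≤ 1 := hsum _
  -- The value lies between two consecutive powers of two, and a request for `n` is made when the
  -- approximations first reach the smaller one.
  obtain ⟨j, hj1, hj2⟩ := exists_nat_pow_near_of_lt_one h0 hle (show (0 : ℝ) < 2⁻¹ by norm_num)
    (by norm_num)
  rw [inv_pow] at hj1 hj2
  obtain ⟨s, hs⟩ := exists_firstReaches (reaches_iff.2 hj1.le)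
  have hreq : codingRequests φ c (Nat.pair n (Nat.pair (j + 1) s)) = some (j + 1 + 1, n) := by
    simp [codingRequests, hs]
  have hm := inv_two_pow_le_m (hK _ _ _ hreq)
  calc fracVal (φ (c, n) t) ≤ ((2 : ℝ) ^ j)⁻¹ := hj2
    _ = 2 ^ (k + 2) * ((2 : ℝ) ^ (j + 1 + 1 + k))⁻¹ := by
        rw [show j + 1 + 1 + k = j + (k + 2) by ring, pow_add _ j]
        field_simp
    _ ≤ 2 ^ (k + 2) * m U n c := by gcongr

/-! ### The measure of the programs with a given output -/

/-- The code `e` computes the machine `U`. -/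
def Computes (e : Code) (U : List Bool → ℕ →. ℕ) : Prop :=
  ∀ p c v, v ∈ e.eval (encode (p, c)) ↔ v ∈ U p c

theorem exists_computes (hU : Partrec₂ U) : ∃ e : Code, Computes e U := by
  obtain ⟨e, he⟩ := Code.exists_code.1 hU
  refine ⟨e, fun p c v => ?_⟩
  rw [he]
  change v ∈ Part.bind (Part.ofOption (decode (encode (p, c)) : Option (List Bool × ℕ)))
    (fun a : List Bool × ℕ => Part.map encode (U a.1 a.2)) ↔ _
  rw [encodek]
  simp

/-- The output, if any, of the program `p` with condition `c` within `t` steps. -/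
def run (e : Code) (t c : ℕ) (p : List Bool) : Option ℕ := Code.evaln t e (encode (p, c))

theorem primrec_run (e : Code) : Primrec fun a : (ℕ × ℕ) × List Bool => run e a.1.1 a.1.2 a.2 :=
  Code.primrec_evaln.comp (((Primrec.fst.comp Primrec.fst).pair (Primrec.const e)).pair
    (Primrec.encode.comp (Primrec.snd.pair (Primrec.snd.comp Primrec.fst))))

theorem run_mono {e : Code} {s t c v : ℕ} {p : List Bool} (hst : s ≤ t)
    (h : run e s c p = some v) : run e t c p = some v :=
  Code.evaln_mono hst h

theorem Computes.mem_of_run {e : Code} (he : Computes e U) {t c v : ℕ}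
    {p : List Bool} (h : run e t c p = some v) : v ∈ U p c :=
  (he p c v).1 (Code.evaln_sound h)

theorem Computes.exists_run {e : Code} (he : Computes e U) {c v : ℕ}
    {p : List Bool} (h : v ∈ U p c) : ∃ t, run e t c p = some v :=
  Code.evaln_complete.1 ((he p c v).2 h)

/-- The programs with code less than `t`. -/
noncomputable def progs (t : ℕ) : Finset (List Bool) :=
  (Finset.range t).preimage encode encode_injective.injOn

theorem mem_progs {t : ℕ} {p : List Bool} : p ∈ progs t ↔ encode p < t := by simp [progs]

theorem encode_lt_of_run {e : Code} {t c v : ℕ} {p : List Bool} (h : run e t c p = some v) :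
    encode p < t :=
  (Nat.left_le_pair _ _).trans_lt (Code.evaln_bound h)

/-- The measure of the programs whose output with condition `c`, within `t` steps, is mapped to `q`
by `g`. -/
noncomputable def outMeasure (g : ℕ → ℕ) (e : Code) (c q t : ℕ) : ℝ :=
  ∑ p ∈ progs t, if (run e t c p).map g = some q then ((2 : ℝ) ^ p.length)⁻¹ else 0

theorem monotone_outMeasure (g : ℕ → ℕ) (e : Code) (c q : ℕ) :
    Monotone (outMeasure g e c q) := by
  intro s t hst
  have hsub : progs s ⊆ progs t := fun p hp => mem_progs.2 ((mem_progs.1 hp).trans_le hst)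
  refine le_trans (Finset.sum_le_sum fun p _ => ?_)
    (Finset.sum_le_sum_of_subset_of_nonneg hsub fun p _ _ => by split_ifs <;> positivity)
  split_ifs with h1 h2 h2
  · exact le_rfl
  · obtain ⟨v, hv, hg⟩ := Option.map_eq_some_iff.1 h1
    exact absurd (by rw [run_mono hst hv, Option.map_some, hg]) h2
  · positivity
  · exact le_rfl

theorem sum_ite_eq_some_le (o : Option ℕ) {h : ℕ → ℕ} (hh : Function.Injective h)
    (F : Finset ℕ) {P : Prop} [Decidable P] (hP : ∀ b, o = some (h b) → P) {x : ℝ} (hx : 0 ≤ x) :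
    ∑ b ∈ F, (if o = some (h b) then x else 0) ≤ if P then x else 0 := by
  by_cases hex : ∃ b ∈ F, o = some (h b)
  · obtain ⟨b, hb, ho⟩ := hex
    rw [if_pos (hP b ho), Finset.sum_eq_single b]
    · rw [if_pos ho]
    · intro b' _ hne
      rw [if_neg]
      intro ho'
      exact hne (hh (Option.some.inj (ho'.symm.trans ho)))
    · exact fun h => absurd hb h
  · rw [Finset.sum_eq_zero fun b hb => if_neg fun ho => hex ⟨b, hb, ho⟩]
    split_ifs
    exacts [hx, le_rfl]

/-- By the Kraft inequality, since each halting program contributes to at most one `q`. -/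
theorem sum_outMeasure_le_one (hU : IsPrefixMachine U) {e : Code}
    (he : Computes e U) (g : ℕ → ℕ) (c t : ℕ) (F : Finset ℕ) :
    ∑ q ∈ F, outMeasure g e c q t ≤ 1 := by
  unfold outMeasure
  rw [Finset.sum_comm]
  refine (Finset.sum_le_sum fun p _ => sum_ite_eq_some_le _ Function.injective_id F
    (P := (run e t c p).isSome = true) (fun b hb => ?_) (by positivity)).trans ?_
  · rw [← Option.isSome_map (f := g), hb]; rfl
  · rw [← Finset.sum_filter]
    refine kraft_of_prefixFree _ fun p hp q hq hpq => ?_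
    obtain ⟨v, hv⟩ := Option.isSome_iff_exists.1 (Finset.mem_filter.1 hp).2
    obtain ⟨w, hw⟩ := Option.isSome_iff_exists.1 (Finset.mem_filter.1 hq).2
    exact hU.prefix_free c p q (Part.dom_iff_mem.2 ⟨v, he.mem_of_run hv⟩)
      (Part.dom_iff_mem.2 ⟨w, he.mem_of_run hw⟩) hpq

/-- The measure of the programs for a pair, summed over the second component. -/
theorem sum_outMeasure_pair_le (e : Code) (c a t : ℕ) (F : Finset ℕ) :
    ∑ b ∈ F, outMeasure id e c (Nat.pair a b) t ≤ outMeasure (fun v => v.unpair.1) e c a t := by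
  unfold outMeasure
  rw [Finset.sum_comm]
  refine Finset.sum_le_sum fun p _ => sum_ite_eq_some_le _ (h := Nat.pair a) (fun b b' hb => ?_) F
    (fun b hb => ?_) (by positivity)
  · have := congrArg (fun n => n.unpair.2) hb
    simpa using this
  · rw [Option.map_id, id] at hb
    rw [hb]
    simp

theorem le_outMeasure {g : ℕ → ℕ} {e : Code} {c t v : ℕ} {p : List Bool}
    (h : run e t c p = some v) : ((2 : ℝ) ^ p.length)⁻¹ ≤ outMeasure g e c (g v) t := by
  have hp : p ∈ progs t := mem_progs.2 (encode_lt_of_run h)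
  refine le_of_eq_of_le ?_ (Finset.single_le_sum (fun p _ => ?_) hp)
  · rw [h]; simp
  · split_ifs <;> positivity

/-- The numerator of `outMeasure g e c q t` over the denominator `2 ^ t`. As `decode₂` rejects
numbers which are not the code of a program, each program counts once. -/
def outNum (g : ℕ → ℕ) (e : Code) (c q t : ℕ) : ℕ :=
  ∑ i ∈ Finset.range t, (decode₂ (List Bool) i).casesOn 0 fun p =>
    if (run e t c p).map g = some q then 2 ^ (t - p.length) else 0

theorem outNum_div (g : ℕ → ℕ) (e : Code) (c q t : ℕ) :
    (outNum g e c q t : ℝ) / 2 ^ t = outMeasure g e c q t := by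
  unfold outNum outMeasure progs
  rw [Nat.cast_sum, ← Finset.sum_preimage (encode : List Bool → ℕ) (Finset.range t)
    encode_injective.injOn, Finset.sum_div]
  · refine Finset.sum_congr rfl fun p hp => ?_
    have hlen : p.length ≤ t :=
      (length_le_encode p).trans (by simpa using (Finset.mem_preimage.1 hp) : encode p < t).le
    rw [decode₂_encode]
    dsimp only
    split_ifs
    · obtain ⟨d, rfl⟩ := Nat.exists_eq_add_of_le hlen
      rw [Nat.add_sub_cancel_left, pow_add]
      push_cast
      field_simp
    · simp
  · intro i _ hi
    have : decode₂ (List Bool) i = none := by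
      by_contra hne
      exact hi (decode₂_ne_none_iff.1 hne)
    rw [this]
    simp

theorem primrec_sum_range {α : Type*} [Primcodable α] {f : α → ℕ → ℕ} {n : α → ℕ}
    (hf : Primrec₂ f) (hn : Primrec n) : Primrec fun a => ∑ i ∈ Finset.range (n a), f a i := by
  have hstep : Primrec fun b : α × ℕ × ℕ => b.2.2 + f b.1 b.2.1 :=
    Primrec.nat_add.comp (Primrec.snd.comp Primrec.snd)
      (hf.comp Primrec.fst (Primrec.fst.comp Primrec.snd))
  refine (Primrec.nat_rec' hn (Primrec.const 0) hstep.to₂).of_eq fun a => ?_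
  induction n a with
  | zero => rfl
  | succ k ih => rw [Finset.sum_range_succ, ← ih]

theorem primrec_outNum {g : ℕ → ℕ} (hg : Primrec g) (e : Code) :
    Primrec fun a : (ℕ × ℕ) × ℕ => outNum g e a.1.1 a.1.2 a.2 := by
  refine primrec_sum_range (α := (ℕ × ℕ) × ℕ) (f := fun a i =>
    (decode₂ (List Bool) i).casesOn 0 fun p =>
      if (run e a.2 a.1.1 p).map g = some a.1.2 then 2 ^ (a.2 - p.length) else 0) ?_ Primrec.snd
  have ha : Primrec fun b : (((ℕ × ℕ) × ℕ) × ℕ) × List Bool => b.1.1 :=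
    Primrec.fst.comp Primrec.fst
  have hp : Primrec fun b : (((ℕ × ℕ) × ℕ) × ℕ) × List Bool => b.2 := Primrec.snd
  have hc := Primrec.fst.comp (Primrec.fst.comp ha)
  have hq := Primrec.snd.comp (Primrec.fst.comp ha)
  have ht := Primrec.snd.comp ha
  have hrun := (primrec_run e).comp ((ht.pair hc).pair hp)
  exact Primrec.option_casesOn (Primrec.decode₂.comp Primrec.snd) (Primrec.const 0)
    (Primrec.ite (Primrec.eq.comp (Primrec.option_map hrun (hg.comp Primrec.snd).to₂)
      (Primrec.option_some.comp hq))
      (primrec_two_pow.comp (Primrec.nat_sub.comp ht (Primrec.list_length.comp hp)))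
      (Primrec.const 0)).to₂

/-! ### Conditional complexity of pairs -/

theorem m_eq_inv {α β : Type} [Primcodable α] [Primcodable β] (x : α)
    (y : β) : m U x y = ((2 : ℝ) ^ condK U x y)⁻¹ := by
  rw [m, zpow_neg, zpow_natCast]

/-- The approximations `fun c q t ↦ outMeasure g e c q t` as fractions. -/
def outFrac (g : ℕ → ℕ) (e : Code) (a : ℕ × ℕ) (t : ℕ) : ℕ × ℕ := (outNum g e a.1 a.2 t, 2 ^ t)

theorem fracVal_outFrac (g : ℕ → ℕ) (e : Code) (c q t : ℕ) :
    fracVal (outFrac g e (c, q) t) = outMeasure g e c q t := by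
  rw [← outNum_div]
  simp [fracVal, outFrac]

theorem primrec_outFrac {g : ℕ → ℕ} (hg : Primrec g) (e : Code) : Primrec₂ (outFrac g e) :=
  (primrec_outNum hg e).pair (primrec_two_pow.comp Primrec.snd)

/-- For a condition `⟨w, ⟨a, k⟩⟩` and an object `b`, `2 ^ (k - d)` times the measure of the programs
for `⟨a, b⟩` with condition `w`. If `k` is the complexity of `a` given `w` this is a semimeasure
in `b`, for large `d`. -/
def pairFrac (e : Code) (d : ℕ) (x : ℕ × ℕ) (t : ℕ) : ℕ × ℕ :=
  (2 ^ x.1.unpair.2.unpair.2 *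
    outNum id e x.1.unpair.1 (Nat.pair x.1.unpair.2.unpair.1 x.2) t, 2 ^ d * 2 ^ t)

theorem fracVal_pairFrac (e : Code) (d w a k b t : ℕ) :
    fracVal (pairFrac e d (Nat.pair w (Nat.pair a k), b) t) =
      2 ^ k / 2 ^ d * outMeasure id e w (Nat.pair a b) t := by
  rw [← outNum_div]
  simp only [fracVal, pairFrac, Nat.unpair_pair]
  push_cast
  rw [mul_div_mul_comm]

theorem primrec_pairFrac (e : Code) (d : ℕ) : Primrec₂ (pairFrac e d) := by
  have hc : Primrec fun x : (ℕ × ℕ) × ℕ => x.1.1.unpair :=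
    Primrec.unpair.comp (Primrec.fst.comp Primrec.fst)
  have hc' : Primrec fun x : (ℕ × ℕ) × ℕ => x.1.1.unpair.2.unpair :=
    Primrec.unpair.comp (Primrec.snd.comp hc)
  have hb : Primrec fun x : (ℕ × ℕ) × ℕ => x.1.2 := Primrec.snd.comp Primrec.fst
  have hn := (primrec_outNum Primrec.id e).comp (((Primrec.fst.comp hc).pair
    (Primrec₂.natPair.comp (Primrec.fst.comp hc') hb)).pair Primrec.snd)
  exact (Primrec.nat_mul.comp (primrec_two_pow.comp (Primrec.snd.comp hc')) hn).pair
    (Primrec.nat_mul.comp (Primrec.const (2 ^ d)) (primrec_two_pow.comp Primrec.snd))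

/-- The hard half of the chain rule. By the coding theorem the measure of the programs for pairs
`⟨a, b⟩`, with `a` fixed, is at most about `2 ^ (-K(a | w))`. So `w`, `a` and `K(a | w)` suffice
to enumerate a semimeasure that exceeds `2 ^ (K(a | w) - K(⟨a, b⟩ | w))` at `b`, up to a constant
factor, and the coding theorem applies again. -/
theorem exists_condK_add_le_condK_pair (hU : IsUniversalPrefixMachine U) :
    ∃ k : ℕ, ∀ w a b : ℕ, condK U a w + condK U b (Nat.pair w (Nat.pair a (condK U a w))) ≤
      condK U (Nat.pair a b) w + k := by
  obtain ⟨e, he⟩ := exists_computes hU.partrec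
  have hfst : Primrec fun v : ℕ => v.unpair.1 := Primrec.fst.comp Primrec.unpair
  obtain ⟨d, hd⟩ := exists_fracVal_le_m hU (primrec_outFrac hfst e).to_comp
  obtain ⟨k, hk⟩ := exists_fracVal_le_m hU (primrec_pairFrac e d).to_comp
  have hd' : ∀ w a t, outMeasure (fun v => v.unpair.1) e w a t ≤ 2 ^ d * m U a w := by
    intro w a t
    rw [← fracVal_outFrac]
    refine hd w (fun n => ?_) (fun N => ?_) a t
    · simp only [fracVal_outFrac]
      exact monotone_outMeasure _ e w n
    · simp only [fracVal_outFrac]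
      exact sum_outMeasure_le_one hU.toIsPrefixMachine he _ w N _
  refine ⟨d + k, fun w a b => ?_⟩
  obtain ⟨p, hp, hl⟩ := exists_program_length_eq hU (Nat.pair a b) w
  obtain ⟨t, ht⟩ := he.exists_run hp
  have hb := hk (Nat.pair w (Nat.pair a (condK U a w))) (fun n => ?_) (fun N => ?_) b t
  · rw [fracVal_pairFrac, m_eq_inv] at hb
    have hp' := le_outMeasure (g := id) ht
    rw [hl] at hp'
    have h := (mul_le_mul_of_nonneg_left hp'
      (show (0 : ℝ) ≤ 2 ^ condK U a w / 2 ^ d by positivity)).trans hb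
    rw [← div_eq_mul_inv, ← div_eq_mul_inv, div_div,
      div_le_div_iff₀ (by positivity) (by positivity), ← pow_add, ← pow_add, ← pow_add,
      pow_le_pow_iff_right₀ (by norm_num)] at h
    omega
  · simp only [fracVal_pairFrac]
    exact fun s t hst => mul_le_mul_of_nonneg_left (monotone_outMeasure _ e w _ hst)
      (by positivity)
  · simp only [fracVal_pairFrac]
    rw [← Finset.mul_sum]
    calc (2 : ℝ) ^ condK U a w / 2 ^ d *
          ∑ n ∈ Finset.range N, outMeasure id e w (Nat.pair a n) N
        ≤ 2 ^ condK U a w / 2 ^ d * (2 ^ d * m U a w) := by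
          gcongr
          exact (sum_outMeasure_pair_le e w a N _).trans (hd' w a N)
      _ = 1 := by
          rw [m_eq_inv]
          field_simp

/-! ### Elementary bounds -/

/-- A condition from which `d` can be computed is as good as `d`. -/
theorem exists_condK_le_of_condition (hU : IsUniversalPrefixMachine U) {g : ℕ →. ℕ}
    (hg : Partrec g) : ∃ k : ℕ, ∀ c d : ℕ, d ∈ g c → ∀ n : ℕ, condK U n c ≤ condK U n d + k := by
  have hT : IsPrefixMachine fun p c => (g c).bind (U p) := by
    refine ⟨Partrec.bind (hg.comp Computable.snd)
      (hU.partrec.comp (Computable.fst.comp Computable.fst) Computable.snd).to₂, ?_⟩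
    rintro c p q ⟨_, hp⟩ ⟨_, hq⟩ hpq
    exact hU.prefix_free _ p q hp hq hpq
  obtain ⟨k, hk⟩ := exists_condK_le_of_machine hU hT
  refine ⟨k, fun c d hd n => ?_⟩
  obtain ⟨p, hp, hl⟩ := exists_program_length_eq hU n d
  rw [← hl]
  exact hk p c n (Part.mem_bind hd hp)

theorem exists_condK_comp_le (hU : IsUniversalPrefixMachine U) {f : ℕ → ℕ} (hf : Computable f) :
    ∃ k : ℕ, ∀ n c : ℕ, condK U (f n) c ≤ condK U n c + k := by
  have hT : IsPrefixMachine fun p c => (U p c).map f :=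
    ⟨Partrec.map hU.partrec (hf.comp Computable.snd).to₂,
      fun c p q hp hq hpq => hU.prefix_free c p q hp hq hpq⟩
  obtain ⟨k, hk⟩ := exists_condK_le_of_machine hU hT
  refine ⟨k, fun n c => ?_⟩
  obtain ⟨p, hp, hl⟩ := exists_program_length_eq hU n c
  rw [← hl]
  exact hk p c (f n) (Part.mem_map f hp)

/-- For `i = ⟨j, s⟩`, the output, if any, of a concatenation `r = p ++ q` with `|p| = j` when each
part is run for `s` steps: it is the pair of the output of `p` with condition `c`, and the output of
`q` with condition `⟨p, c⟩`. -/
def pairStage (e : Code) (r : List Bool) (c : ℕ) (i : ℕ) : Option ℕ :=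
  (run e i.unpair.2 c (r.take i.unpair.1)).bind fun a =>
    (run e i.unpair.2 (Nat.pair (encode (r.take i.unpair.1)) c) (r.drop i.unpair.1)).map
      fun b => Nat.pair a b

theorem primrec_pairStage (e : Code) :
    Primrec fun x : (List Bool × ℕ) × ℕ => pairStage e x.1.1 x.1.2 x.2 := by
  have hu : Primrec fun x : (List Bool × ℕ) × ℕ => x.2.unpair := Primrec.unpair.comp Primrec.snd
  have hr : Primrec fun x : (List Bool × ℕ) × ℕ => x.1.1 := Primrec.fst.comp Primrec.fst
  have hc : Primrec fun x : (List Bool × ℕ) × ℕ => x.1.2 := Primrec.snd.comp Primrec.fst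
  have hp := Primrec.list_take.comp (Primrec.fst.comp hu) hr
  have hq := Primrec.list_drop.comp (Primrec.fst.comp hu) hr
  have ht := Primrec.snd.comp hu
  have h1 := (primrec_run e).comp ((ht.pair hc).pair hp)
  have h2 := (primrec_run e).comp
    ((ht.pair (Primrec₂.natPair.comp (Primrec.encode.comp hp) hc)).pair hq)
  exact Primrec.option_bind h1 (Primrec.option_map (h2.comp Primrec.fst)
    (Primrec₂.natPair.comp (Primrec.snd.comp Primrec.fst) Primrec.snd).to₂).to₂

theorem exists_split_of_pairStage {e : Code} (he : Computes e U) {r : List Bool} {c i v : ℕ}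
    (h : pairStage e r c i = some v) : ∃ p q a b, r = p ++ q ∧ a ∈ U p c ∧
      b ∈ U q (Nat.pair (encode p) c) ∧ v = Nat.pair a b := by
  obtain ⟨a, ha, h⟩ := Option.bind_eq_some_iff.1 h
  obtain ⟨b, hb, h⟩ := Option.map_eq_some_iff.1 h
  exact ⟨_, _, a, b, (List.take_append_drop _ r).symm, he.mem_of_run ha, he.mem_of_run hb, h.symm⟩

/-- A concatenation of two programs, the second of which has access to the first, splits in only
one way. -/
theorem split_unique (hU : IsPrefixMachine U) {p q p' q' : List Bool} {c a a' b b' : ℕ}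
    (ha : a ∈ U p c) (hb : b ∈ U q (Nat.pair (encode p) c)) (ha' : a' ∈ U p' c)
    (hb' : b' ∈ U q' (Nat.pair (encode p') c)) (h : p ++ q <+: p' ++ q') : p = p' ∧ q = q' := by
  have hp : p = p' := by
    rcases List.prefix_or_prefix_of_prefix ((List.prefix_append p q).trans h)
      (List.prefix_append p' q') with hpp | hpp
    · exact hU.prefix_free c _ _ (Part.dom_iff_mem.2 ⟨a, ha⟩) (Part.dom_iff_mem.2 ⟨a', ha'⟩) hpp
    · exact (hU.prefix_free c _ _ (Part.dom_iff_mem.2 ⟨a', ha'⟩) (Part.dom_iff_mem.2 ⟨a, ha⟩)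
        hpp).symm
  subst hp
  exact ⟨rfl, hU.prefix_free _ _ _ (Part.dom_iff_mem.2 ⟨b, hb⟩) (Part.dom_iff_mem.2 ⟨b', hb'⟩)
    ((List.prefix_append_right_inj p).1 h)⟩

/-- The easy half of the chain rule, by concatenation of programs. -/
theorem exists_condK_pair_le (hU : IsUniversalPrefixMachine U) :
    ∃ k : ℕ, ∀ (p : List Bool) (a b c : ℕ), a ∈ U p c →
      condK U (Nat.pair a b) c ≤ p.length + condK U b (Nat.pair (encode p) c) + k := by
  obtain ⟨e, he⟩ := exists_computes hU.partrec
  have hT : IsPrefixMachine fun r c => Nat.rfindOpt (pairStage e r c) := by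
    refine ⟨Partrec.rfindOpt (primrec_pairStage e).to_comp.to₂, fun c r r' hr hr' h => ?_⟩
    obtain ⟨i, v, hv⟩ := Nat.rfindOpt_dom.1 hr
    obtain ⟨j, w, hw⟩ := Nat.rfindOpt_dom.1 hr'
    obtain ⟨p, q, a, b, rfl, ha, hb, -⟩ := exists_split_of_pairStage he hv
    obtain ⟨p', q', a', b', rfl, ha', hb', -⟩ := exists_split_of_pairStage he hw
    obtain ⟨rfl, rfl⟩ := split_unique hU.toIsPrefixMachine ha hb ha' hb' h
    rfl
  obtain ⟨k, hk⟩ := exists_condK_le_of_machine hU hT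
  refine ⟨k, fun p a b c ha => ?_⟩
  obtain ⟨q, hq, hl⟩ := exists_program_length_eq hU b (Nat.pair (encode p) c)
  have hq : b ∈ U q (Nat.pair (encode p) c) := hq
  rw [← hl, ← List.length_append]
  refine hk (p ++ q) c _ ?_
  obtain ⟨s, hs⟩ := he.exists_run ha
  obtain ⟨t, ht⟩ := he.exists_run hq
  have hstage : pairStage e (p ++ q) c (Nat.pair p.length (max s t)) = some (Nat.pair a b) := by
    simp [pairStage, run_mono (le_max_left s t) hs, run_mono (le_max_right s t) ht]
  obtain ⟨v, hv⟩ := Part.dom_iff_mem.1 (Nat.rfindOpt_dom.2 ⟨_, _, hstage⟩)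
  obtain ⟨i, hi⟩ := Nat.rfindOpt_spec hv
  obtain ⟨p', q', a', b', hpq, ha', hb', rfl⟩ := exists_split_of_pairStage he hi
  obtain ⟨rfl, rfl⟩ := split_unique hU.toIsPrefixMachine ha hq ha' hb' (hpq ▸ List.prefix_refl _)
  rwa [Part.mem_unique ha ha', Part.mem_unique hq hb']

theorem partrec_unpair_fst : Partrec fun n : ℕ => Part.some n.unpair.1 :=
  (Primrec.fst.comp Primrec.unpair).to_comp.partrec

theorem partrec_unpair_snd : Partrec fun n : ℕ => Part.some n.unpair.2 :=
  (Primrec.snd.comp Primrec.unpair).to_comp.partrec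

theorem exists_condK_pair_le_add (hU : IsUniversalPrefixMachine U) :
    ∃ k : ℕ, ∀ a b c : ℕ, condK U (Nat.pair a b) c ≤ condK U a c + condK U b c + k := by
  obtain ⟨k, hk⟩ := exists_condK_pair_le hU
  obtain ⟨k', hk'⟩ := exists_condK_le_of_condition hU partrec_unpair_snd
  refine ⟨k + k', fun a b c => ?_⟩
  obtain ⟨p, hp, hl⟩ := exists_program_length_eq hU a c
  have h1 := hk p a b c hp
  have h2 := hk' (Nat.pair (encode p) c) c (by simp) b
  omega

/-! ### The chain rule for shortest programs -/

theorem exists_condK_pair_le_star (hU : IsUniversalPrefixMachine U) :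
    ∃ k : ℕ, ∀ (x : List Bool) (b : ℕ),
      condK U (Nat.pair (encode x) b) 0 ≤ K U x + condK U b (encode (star U x)) + k := by
  obtain ⟨k, hk⟩ := exists_condK_pair_le hU
  obtain ⟨k', hk'⟩ := exists_condK_le_of_condition hU partrec_unpair_fst
  refine ⟨k + k', fun x b => ?_⟩
  have h1 := hk _ _ b 0 (star_mem hU x)
  have h2 := hk' (Nat.pair (encode (star U x)) 0) (encode (star U x)) (by simp) b
  rw [length_star hU] at h1
  omega

/-- A shortest program of an object computes both the object and its complexity, so that the hard
half of the chain rule applies. -/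
theorem exists_star_add_le_condK_pair (hU : IsUniversalPrefixMachine U) :
    ∃ k : ℕ, ∀ (x : List Bool) (b : ℕ),
      K U x + condK U b (encode (star U x)) ≤ condK U (Nat.pair (encode x) b) 0 + k := by
  obtain ⟨k, hk⟩ := exists_condK_add_le_condK_pair hU
  have hg : Partrec fun c : ℕ => (decode (α := List Bool) c : Part (List Bool)).bind fun p =>
      (U p 0).map fun a => Nat.pair 0 (Nat.pair a p.length) := by
    refine Partrec.bind Computable.decode.ofOption (Partrec.map
      (hU.partrec.comp Computable.snd (Computable.const 0)) ?_)
    exact (Primrec₂.natPair.comp (Primrec.const 0) (Primrec₂.natPair.comp Primrec.snd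
      (Primrec.list_length.comp (Primrec.snd.comp Primrec.fst)))).to_comp.to₂
  obtain ⟨k', hk'⟩ := exists_condK_le_of_condition hU hg
  refine ⟨k + k', fun x b => ?_⟩
  have h1 := hk 0 (encode x) b
  have h2 := hk' (encode (star U x)) (Nat.pair 0 (Nat.pair (encode x) (K U x))) (by
    rw [encodek]
    simp only [Part.coe_some, Part.bind_some, ← length_star hU x]
    exact Part.mem_map _ (star_mem hU x)) b
  rw [← K_eq_condK_zero] at h1
  omega

/-! ### Non-increase of information -/

/-- The core inequality. By the chain rule, up to constants,
`K(y | x*) + K(z | x*, y, K(y | x*))` is `K(⟨y, z⟩ | x*)`, hence `K(⟨x, y, z⟩) - K(x)`. As `y` and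
`x` can be computed separately from `z*`, this is at most `K(z) + K(y | z*) + K(x | z*) - K(x)`, where
`K(z) + K(x | z*)` is `K(⟨x, z⟩)`, hence `K(x) + K(z | x*)`. -/
theorem exists_condK_add_le (hU : IsUniversalPrefixMachine U) :
    ∃ k : ℕ, ∀ x y z : List Bool,
      condK U y (star U x) + condK U z (star U x, y, condK U y (star U x)) ≤
        condK U z (star U x) + condK U y (star U z) + k := by
  obtain ⟨k₁, h₁⟩ := exists_condK_add_le_condK_pair hU
  obtain ⟨k₂, h₂⟩ := exists_star_add_le_condK_pair hU
  obtain ⟨k₃, h₃⟩ := exists_condK_pair_le_star hU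
  obtain ⟨k₄, h₄⟩ := exists_condK_pair_le_add hU
  have hu : Primrec Nat.unpair := Primrec.unpair
  have hu' : Primrec fun n : ℕ => n.unpair.2.unpair := hu.comp (Primrec.snd.comp hu)
  obtain ⟨k₅, h₅⟩ := exists_condK_comp_le hU
    (f := fun n => Nat.pair n.unpair.2.unpair.2 (Nat.pair n.unpair.2.unpair.1 n.unpair.1))
    (Primrec₂.natPair.comp (Primrec.snd.comp hu')
      (Primrec₂.natPair.comp (Primrec.fst.comp hu') (Primrec.fst.comp hu))).to_comp
  obtain ⟨k₆, h₆⟩ := exists_condK_comp_le hU (f := fun n => Nat.pair n.unpair.2 n.unpair.1)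
    (Primrec₂.natPair.comp (Primrec.snd.comp hu) (Primrec.fst.comp hu)).to_comp
  refine ⟨k₁ + k₂ + k₃ + k₄ + k₅ + k₂ + k₆ + k₃, fun x y z => ?_⟩
  -- The ascribed types restate the bounds on codes as bounds on the objects coded.
  have e₁ : condK U y (star U x) + condK U z (star U x, y, condK U y (star U x)) ≤
      condK U (Nat.pair (encode y) (encode z)) (encode (star U x)) + k₁ :=
    h₁ (encode (star U x)) (encode y) (encode z)
  have e₂ := h₂ x (Nat.pair (encode y) (encode z))
  have e₃ := h₅ (Nat.pair (encode z) (Nat.pair (encode y) (encode x))) 0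
  simp only [Nat.unpair_pair] at e₃
  have e₄ := h₃ z (Nat.pair (encode y) (encode x))
  have e₅ : condK U (Nat.pair (encode y) (encode x)) (encode (star U z)) ≤
      condK U y (star U z) + condK U (encode x) (encode (star U z)) + k₄ :=
    h₄ (encode y) (encode x) (encode (star U z))
  have e₆ := h₂ z (encode x)
  have e₇ := h₆ (Nat.pair (encode x) (encode z)) 0
  simp only [Nat.unpair_pair] at e₇
  have e₈ : condK U (Nat.pair (encode x) (encode z)) 0 ≤
      K U x + condK U z (star U x) + k₃ := h₃ x (encode z)
  omega

/-- The term `K(y)` cancels in the exponent, which is `K(y | x*) - K(y | z*)`. -/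
theorem exists_m_mul_two_zpow_le (hU : IsUniversalPrefixMachine U) :
    ∃ k : ℕ, ∀ x y z : List Bool,
      m U z (star U x) * (2 : ℝ) ^ (I U z y - I U x y) ≤
        2 ^ k * m U z (star U x, y, condK U y (star U x)) := by
  obtain ⟨k, hk⟩ := exists_condK_add_le hU
  refine ⟨k, fun x y z => ?_⟩
  have h := hk x y z
  rw [m, m, ← zpow_natCast, ← zpow_add₀ (by norm_num), ← zpow_add₀ (by norm_num)]
  refine zpow_le_zpow_right₀ (by norm_num) ?_
  unfold I
  omega

theorem exists_sum_m_mul_two_zpow_le (hU : IsUniversalPrefixMachine U) :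
    ∃ C : ℝ, 0 ≤ C ∧ ∀ (x y : List Bool) (F : Finset (List Bool)),
      ∑ z ∈ F, m U z (star U x) * (2 : ℝ) ^ (I U z y - I U x y) ≤ C := by
  obtain ⟨k, hk⟩ := exists_m_mul_two_zpow_le hU
  refine ⟨2 ^ k, by positivity, fun x y F => (Finset.sum_le_sum fun z _ => hk x y z).trans ?_⟩
  rw [← Finset.mul_sum]
  exact mul_le_of_le_one_right (by positivity) (sum_m_le_one hU _ F)

/-- Markov's inequality for `2 ^ (I(z : y) - I(x : y))`. -/
theorem exists_sum_m_le (hU : IsUniversalPrefixMachine U) :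
    ∃ C : ℝ, 0 ≤ C ∧ ∀ (x y : List Bool) (d : ℤ)
      (F : Finset {z : List Bool // d ≤ I U z y - I U x y}),
      ∑ z ∈ F, m U z.1 (star U x) ≤ C * (2 : ℝ) ^ (-d) := by
  obtain ⟨C, hC, h⟩ := exists_sum_m_mul_two_zpow_le hU
  refine ⟨C, hC, fun x y d F => ?_⟩
  have hF := h x y (F.map (Function.Embedding.subtype _))
  rw [Finset.sum_map] at hF
  refine le_trans ?_ (mul_le_mul_of_nonneg_right hF (by positivity))
  rw [Finset.sum_mul]
  refine Finset.sum_le_sum fun z _ => ?_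
  rw [mul_assoc, ← zpow_add₀ (by norm_num)]
  refine le_mul_of_one_le_right (m_pos _ _).le (one_le_zpow₀ (by norm_num) ?_)
  have := z.2
  simp only [Function.Embedding.subtype_apply]
  omega

/-! ### Randomized processing -/

/-- Approximations of `f(z | x)`, transferred to the codes of `x` and `z`; zero at the numbers which
are not codes. -/
def transferFrac (φ : List Bool × List Bool → ℕ → ℕ × ℕ) (a : ℕ × ℕ) (t : ℕ) : ℕ × ℕ :=
  ((decode₂ (List Bool × List Bool) (Nat.pair a.1 a.2)).map fun b => φ b t).getD (0, 1)

theorem computable_transferFrac {φ : List Bool × List Bool → ℕ → ℕ × ℕ} (hφ : Computable₂ φ) :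
    Computable₂ (transferFrac φ) := by
  have hd : Primrec fun b : (ℕ × ℕ) × ℕ =>
      decode₂ (List Bool × List Bool) (Nat.pair b.1.1 b.1.2) :=
    Primrec.decode₂.comp (Primrec₂.natPair.comp (Primrec.fst.comp Primrec.fst)
      (Primrec.snd.comp Primrec.fst))
  exact Computable.option_getD (Computable.option_map hd.to_comp
    (hφ.comp Computable.snd (Computable.snd.comp Computable.fst)).to₂) (Computable.const (0, 1))

theorem transferFrac_encode (φ : List Bool × List Bool → ℕ → ℕ × ℕ) (x z : List Bool) :
    transferFrac φ (encode x, encode z) = φ (x, z) := by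
  funext t
  have : decode₂ (List Bool × List Bool) (Nat.pair (encode x) (encode z)) = some (x, z) :=
    decode₂_encode (x, z)
  simp [transferFrac, this]

theorem transferFrac_of_notMem {φ : List Bool × List Bool → ℕ → ℕ × ℕ} {x : List Bool} {n : ℕ}
    (hn : n ∉ Set.range (encode : List Bool → ℕ)) :
    transferFrac φ (encode x, n) = fun _ => (0, 1) := by
  funext t
  have : decode₂ (List Bool × List Bool) (Nat.pair (encode x) n) = none := by
    by_contra hne
    obtain ⟨⟨x', z⟩, h⟩ := decode₂_ne_none_iff.1 hne
    have h' : Nat.pair (encode x') (encode z) = Nat.pair (encode x) n := h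
    exact hn ⟨z, (Nat.pair_eq_pair.1 h').2⟩
  simp [transferFrac, this]

/-- The universal probability dominates every randomized computation, also if the condition `x` is
replaced by `x*`. -/
theorem exists_processing_le_m (hU : IsUniversalPrefixMachine U)
    {f : List Bool → List Bool → ℝ} (hf : IsRandomizedProcessing f) :
    ∃ C : ℝ, 0 ≤ C ∧ ∀ x z, f x z ≤ C * m U z (star U x) := by
  obtain ⟨φ, hφ, hmono, hlim⟩ := hf.lowerSemicomputable
  obtain ⟨k, hk⟩ := exists_fracVal_le_m hU (computable_transferFrac hφ)
  obtain ⟨k', hk'⟩ := exists_condK_le_of_condition hU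
    (g := fun c => (decode (α := List Bool) c : Part (List Bool)).bind fun p => U p 0)
    (Partrec.bind Computable.decode.ofOption
      (hU.partrec.comp Computable.snd (Computable.const 0)))
  refine ⟨2 ^ k * 2 ^ k', by positivity, fun x z => ?_⟩
  have hle : ∀ z t, fracVal (φ (x, z) t) ≤ f x z := fun z t =>
    (hmono (x, z)).ge_of_tendsto (hlim (x, z)) t
  have hx : f x z ≤ 2 ^ k * m U z x := by
    refine le_of_tendsto (hlim (x, z)) (Filter.Eventually.of_forall fun t => ?_)
    have h := hk (encode x) (fun n => ?_) (fun N => ?_) (encode z) t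
    · rw [transferFrac_encode] at h
      exact h
    · by_cases hn : n ∈ Set.range (encode : List Bool → ℕ)
      · obtain ⟨z, rfl⟩ := hn
        rw [transferFrac_encode]
        exact hmono (x, z)
      · rw [transferFrac_of_notMem hn]
        exact monotone_const
    · rw [← Finset.sum_preimage (encode : List Bool → ℕ) (Finset.range N)
        encode_injective.injOn]
      · simp only [transferFrac_encode]
        exact (Finset.sum_le_sum fun z _ => hle z N).trans
          (((hf.summable x).sum_le_tsum _ fun z _ => hf.nonneg x z).trans (hf.tsum_le_one x))
      · intro n _ hn
        rw [transferFrac_of_notMem hn]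
        simp [fracVal]
  have hstar := hk' (encode (star U x)) (encode x) (by
    rw [encodek]
    simpa using star_mem hU x) (encode z)
  refine hx.trans ?_
  rw [mul_assoc, m_eq_inv, m_eq_inv, ← div_eq_mul_inv ((2 : ℝ) ^ k')]
  gcongr
  rw [inv_eq_one_div, div_le_div_iff₀ (by positivity) (by positivity), one_mul, ← pow_add]
  refine pow_le_pow_right₀ (by norm_num) ?_
  rw [condK_encode, condK_encode] at hstar
  omega

end Kolmogorov

theorem mainTheorem9 (U : List Bool → ℕ →. ℕ) (hU : IsUniversalPrefixMachine U) :
    (∃ c₃ : ℝ, ∀ x y z : List Bool,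
      Kolmogorov.m U z (Kolmogorov.star U x) *
          (2 : ℝ) ^ (Kolmogorov.I U z y - Kolmogorov.I U x y) ≤
        c₃ * Kolmogorov.m U z
          (Kolmogorov.star U x, y, Kolmogorov.condK U y (Kolmogorov.star U x))) ∧
    (∃ c : ℝ, ∀ x y : List Bool,
      Summable (fun z : List Bool => Kolmogorov.m U z (Kolmogorov.star U x) *
          (2 : ℝ) ^ (Kolmogorov.I U z y - Kolmogorov.I U x y)) ∧
      ∑' z : List Bool, Kolmogorov.m U z (Kolmogorov.star U x) *
          (2 : ℝ) ^ (Kolmogorov.I U z y - Kolmogorov.I U x y) ≤ c) ∧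
    (∃ c : ℝ, ∀ (x y : List Bool) (d : ℤ),
      Summable (fun z : {z : List Bool // d ≤ Kolmogorov.I U z y - Kolmogorov.I U x y} =>
          Kolmogorov.m U z.1 (Kolmogorov.star U x)) ∧
      ∑' z : {z : List Bool // d ≤ Kolmogorov.I U z y - Kolmogorov.I U x y},
          Kolmogorov.m U z.1 (Kolmogorov.star U x) ≤ c * (2 : ℝ) ^ (-d)) ∧
    (∀ f : List Bool → List Bool → ℝ, Kolmogorov.IsRandomizedProcessing f →
      ∃ c : ℝ, ∀ (x y : List Bool) (d : ℤ),
        ∑' z : {z : List Bool // d ≤ Kolmogorov.I U z y - Kolmogorov.I U x y}, f x z.1 ≤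
          c * (2 : ℝ) ^ (-d)) := by
  obtain ⟨k, hk⟩ := Kolmogorov.exists_m_mul_two_zpow_le hU
  obtain ⟨C₂, -, h₂⟩ := Kolmogorov.exists_sum_m_mul_two_zpow_le hU
  obtain ⟨C₃, hC₃, h₃⟩ := Kolmogorov.exists_sum_m_le hU
  refine ⟨⟨2 ^ k, hk⟩, ⟨C₂, fun x y => ?_⟩, ⟨C₃, fun x y d => ?_⟩, fun f hf => ?_⟩
  · have h0 : ∀ z : List Bool, 0 ≤ Kolmogorov.m U z (Kolmogorov.star U x) *
        (2 : ℝ) ^ (Kolmogorov.I U z y - Kolmogorov.I U x y) := fun z =>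
      mul_nonneg (Kolmogorov.m_pos _ _).le (by positivity)
    exact ⟨summable_of_sum_le h0 (h₂ x y), Real.tsum_le_of_sum_le h0 (h₂ x y)⟩
  · have h0 : ∀ z : {z : List Bool // d ≤ Kolmogorov.I U z y - Kolmogorov.I U x y},
        0 ≤ Kolmogorov.m U z.1 (Kolmogorov.star U x) := fun z => (Kolmogorov.m_pos _ _).le
    exact ⟨summable_of_sum_le h0 (h₃ x y d), Real.tsum_le_of_sum_le h0 (h₃ x y d)⟩
  · obtain ⟨C, hC, h⟩ := Kolmogorov.exists_processing_le_m hU hf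
    refine ⟨C * C₃, fun x y d => ?_⟩
    refine Real.tsum_le_of_sum_le (fun z => hf.nonneg x z.1) fun F => ?_
    refine (Finset.sum_le_sum fun z _ => h x z.1).trans ?_
    rw [← Finset.mul_sum, mul_assoc]
    exact mul_le_mul_of_nonneg_left (h₃ x y d F) hC
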